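/- Let $L$ be a first-order language with equality, with arbitrary sets of function symbols (constants are $0$-ary function symbols) and predicate symbols, and a denumerable set of variables. A (positive conjunctive) query over $L$ is a formula built from $\mathrm{True}$, $\mathrm{False}$, equations $s=t$ and atoms $p(t_1,\dots,t_n)$ by $\wedge$ and $\exists$. Conjunctions are written without brackets, i.e. queries are considered up to the associativity of $\wedge$. $|Q|$ denotes the number of atoms of $Q$. **Solved form.** $Q$ is in solved form if it is $\mathrm{True}$ or $\mathrm{False}$ or of the form $(\exists z_1)\dots(\exists z_k)(x_1=s_1\wedge\dots\wedge x_n=s_n\wedge A_1\wedge\dots\wedge A_m)$ with atoms $A_j$, where the $x_i$ and $z_j$ are distinct variables, no $x_i$ occurs in any $s_j$ or $A_j$, each $z_j$ occurs in the conjunction, and no $s_i$ is one of the variables $z_j$. **Algorithm.** Starting from a query, apply nondeterministically any of the following steps, until $\mathrm{False}$ has been returned or no step applies. Steps (1)–(4) replace an equation occurring anywhere in the query: (1) $f(s_1,\dots,s_n)=f(t_1,\dots,t_n)$ by $s_1=t_1\wedge\dots\wedge s_n=t_n$ (by $\mathrm{True}$ if $n=0$); (2) $f(\dots)=g(\dots)$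 by $\mathrm{False}$ if $f\neq g$; (3) $x=t$ by $\mathrm{False}$ if $t\neq x$ and $x$ occurs in $t$; (4) $x=x$ by $\mathrm{True}$. Steps (5)–(7) act on a subquery $(\exists\bar y)(Q'\wedge e\wedge Q'')$, where $Q',Q''$ are (possibly empty) conjunctions of equations and atoms only, $\bar y$ is a possibly empty sequence, and $Q'\wedge e\wedge Q''$ is not a proper part of a longer conjunction: (5) if $e$ is $x=t$, $x$ is not in $t$ and not in $\bar y$, and $x$ occurs in $Q'$ or $Q''$: substitute $t$ for $x$ in $Q'$ and $Q''$; (6) if $e$ is $x=t$, $x$ is not in $t$, and $x$ is in $\bar y$: substitute $t$ for $x$ in $Q'$ and $Q''$ and replace $e$ by $\mathrm{True}$; (7) if $e$ is $t=x$ and either $t$ is not a variable, or $t$ is a variable distinct from $x$ and not in $\bar y$ while $x$ is in $\bar y$: replace $e$ by $x=t$. The other steps are: (8) replace a subquery $(\exists\bar y')(\exists y)(\exists\bar y'')R$ by $(\exists\bar y')(\exists\bar y'')R$ if $y$ is not free in $(\exists\bar y'')R$; (9) replace a subquery $(\exists\bar y_1)Q_1\wedge(\exists\bar y_2)Q_2$,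 where $\bar y_1,\bar y_2$ are not both empty, by $(\exists\bar z_1)(\exists\bar z_2)(R_1\wedge R_2)$, where $(\exists\bar z_i)R_i$ is a variant (renaming of bound variables) of $(\exists\bar y_i)Q_i$, with $\bar z_i$ of the same length as $\bar y_i$, no variable of $\bar z_2$ is free in $R_1$, and no variable of $\bar z_1$ is free in $R_2$; (10) replace $A\wedge s=t$ by $s=t\wedge A$ for an atom $A$; (11) delete a conjunct $\mathrm{True}$; (12) replace the whole query by $\mathrm{False}$ if $\mathrm{False}$ occurs in it. **Equivalence.** A pre-interpretation $J$ is a non-empty domain $D$ with an interpretation of the function symbols. It is a model of the free equality axioms if every $f$ is interpreted by an injective function, distinct function symbols are interpreted by functions with disjoint ranges, and $h(x)\neq h(t)$ for every valuation $h$ whenever $x$ occurs in a term $t\neq x$. A multiinterpretation for $Q$ based on $J$ is a sequence $\bar I$ of $|Q|$ interpretations of the predicate symbols in $D$. A valuation is a solution of $Q$ in $\bar I$ if it satisfies $Q$ when, for each $i$, the $i$-th atom occurrence of $Q$ (from left to right) is read in the $i$-th interpretation of $\bar I$. Queries $Q,Q'$ are equivalent, $Q\approx Q'$, if $|Q|=|Q'|$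 and, for every model $J$ of the free equality axioms, $Q$ and $Q'$ have the same solutions in every multiinterpretation of length $|Q|$ based on $J$. **Theorem.** Let $Q$ be a query. There is no infinite run of the algorithm on $Q$, and the algorithm has an output on $Q$. Every output $Q'$ of the algorithm on $Q$ is in solved form, and: (a) if $Q'$ is not $\mathrm{False}$, or if $|Q|=0$, then $Q\approx Q'$; in particular $|Q'|=|Q|$; (b) if $Q'$ is $\mathrm{False}$, then $Q$ has no solution in any multiinterpretation for $Q$ based on any model of the free equality axioms; (c) in every case $Q\leftrightarrow Q'$ is a logical consequence of the free equality axioms. -/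

import Mathlib

universe u v w

namespace ConjQuery



/-- Positive conjunctive queries over the language `L`; the variables are the natural numbers.
Equality is a logical symbol, `L.Relations` are the other predicate symbols. -/
inductive Query (L : FirstOrder.Language.{u, v}) : Type (max u v)
  | tt : Query L
  | ff : Query L
  | eq (s t : L.Term ℕ) : Query L
  | atom {n : ℕ} (p : L.Relations n) (ts : Fin n → L.Term ℕ) : Query L
  | and (Q₁ Q₂ : Query L) : Query L
  | ex (x : ℕ) (Q : Query L) : Query L

section Syntactic

variable {L : FirstOrder.Language.{u, v}}

/-- The term obtained from `s` by replacing every occurrence of `x` by `t`. -/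
def substTerm (x : ℕ) (t s : L.Term ℕ) : L.Term ℕ :=
  s.subst (fun y => if y = x then t else FirstOrder.Language.Term.var y)

namespace Query

/-- The number of atoms occurring in a query. -/
def card : Query L → ℕ
  | tt => 0
  | ff => 0
  | eq _ _ => 0
  | atom _ _ => 1
  | and Q₁ Q₂ => Q₁.card + Q₂.card
  | ex _ Q => Q.card

/-- The set of free variables. -/
def freeVars : Query L → Finset ℕ
  | tt => ∅
  | ff => ∅
  | eq s t => s.varFinset ∪ t.varFinset
  | atom _ ts => Finset.univ.biUnion (fun i => (ts i).varFinset)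
  | and Q₁ Q₂ => Q₁.freeVars ∪ Q₂.freeVars
  | ex x Q => Q.freeVars.erase x

/-- Replacement of all free occurrences of `x` by `t`. -/
def subst (x : ℕ) (t : L.Term ℕ) : Query L → Query L
  | tt => tt
  | ff => ff
  | eq s₁ s₂ => eq (substTerm x t s₁) (substTerm x t s₂)
  | atom p ts => atom p (fun i => substTerm x t (ts i))
  | and Q₁ Q₂ => and (Q₁.subst x t) (Q₂.subst x t)
  | ex y Q => if y = x then ex y Q else ex y (Q.subst x t)

/-- `t` is substitutible for `x`: no free occurrence of `x` is in the scope of a quantifier that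
binds a variable of `t`. -/
def Substitutible (x : ℕ) (t : L.Term ℕ) : Query L → Prop
  | tt => True
  | ff => True
  | eq _ _ => True
  | atom _ _ => True
  | and Q₁ Q₂ => Q₁.Substitutible x t ∧ Q₂.Substitutible x t
  | ex y Q => x ∉ (ex y Q).freeVars ∨ (y ∉ t.varFinset ∧ Q.Substitutible x t)

/-- The propositional constant `ff` occurs in the query. -/
def HasFF : Query L → Prop
  | tt => False
  | ff => True
  | eq _ _ => False
  | atom _ _ => False
  | and Q₁ Q₂ => Q₁.HasFF ∨ Q₂.HasFF
  | ex _ Q => Q.HasFF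

def IsEquation (Q : Query L) : Prop := ∃ s t, Q = eq s t

def IsAtom (Q : Query L) : Prop :=
  ∃ (n : ℕ) (p : L.Relations n) (ts : Fin n → L.Term ℕ), Q = atom p ts

/-- The conjunction of a list of queries; the empty conjunction is `tt`. -/
def conj : List (Query L) → Query L
  | [] => tt
  | [Q] => Q
  | Q :: Q' :: Qs => and Q (conj (Q' :: Qs))

/-- The query `(∃ y₁) … (∃ yₖ) Q`. -/
def exs (ys : List ℕ) (Q : Query L) : Query L := ys.foldr ex Q

end Query

open Query

/-- `Everywhere r Q Q'`: one subquery `P` of `Q` is replaced by some `P'` with `r P P'`. -/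
inductive Everywhere (r : Query L → Query L → Prop) : Query L → Query L → Prop
  | here {P P' : Query L} : r P P' → Everywhere r P P'
  | andLeft {P P' : Query L} (R : Query L) :
      Everywhere r P P' → Everywhere r (and P R) (and P' R)
  | andRight {P P' : Query L} (R : Query L) :
      Everywhere r P P' → Everywhere r (and R P) (and R P')
  | ex {P P' : Query L} (x : ℕ) : Everywhere r P P' → Everywhere r (ex x P) (ex x P')

inductive AssocRule : Query L → Query L → Prop
  | assoc (P Q R : Query L) : AssocRule (and (and P Q) R) (and P (and Q R))

/-- The two queries differ only in the bracketing of their conjunctions. -/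
def AssocEq : Query L → Query L → Prop := Relation.EqvGen (Everywhere AssocRule)

inductive RenameRule : Query L → Query L → Prop
  | rename (x y : ℕ) (G : Query L) : y ∉ G.freeVars →
      G.Substitutible x (FirstOrder.Language.Term.var y) →
      RenameRule (ex x G) (ex y (G.subst x (FirstOrder.Language.Term.var y)))

/-- `Variant F F'`: `F'` is obtained from `F` by finitely many renamings of bound variables. -/
def Variant : Query L → Query L → Prop := Relation.ReflTransGen (Everywhere RenameRule)

/-- Steps (1)-(4) and (8)-(11), which act on an arbitrary subquery. -/
inductive LocalRule : Query L → Query L → Prop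
  | r1 {n : ℕ} (f : L.Functions n) (s t : Fin n → L.Term ℕ) :
      LocalRule (eq (FirstOrder.Language.Term.func f s) (FirstOrder.Language.Term.func f t))
        (conj (List.ofFn fun i => eq (s i) (t i)))
  | r2 {n m : ℕ} (f : L.Functions n) (g : L.Functions m)
      (s : Fin n → L.Term ℕ) (t : Fin m → L.Term ℕ) :
      (⟨n, f⟩ : Σ k, L.Functions k) ≠ ⟨m, g⟩ →
      LocalRule (eq (FirstOrder.Language.Term.func f s) (FirstOrder.Language.Term.func g t)) ff
  | r3 (x : ℕ) (t : L.Term ℕ) : t ≠ FirstOrder.Language.Term.var x → x ∈ t.varFinset →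
      LocalRule (eq (FirstOrder.Language.Term.var x) t) ff
  | r4 (x : ℕ) : LocalRule (eq (FirstOrder.Language.Term.var x) (FirstOrder.Language.Term.var x)) tt
  | r8 (ys zs : List ℕ) (y : ℕ) (Q : Query L) : y ∉ (exs zs Q).freeVars →
      LocalRule (exs (ys ++ y :: zs) Q) (exs (ys ++ zs) Q)
  | r9 (ys₁ ys₂ zs₁ zs₂ : List ℕ) (Q₁ Q₂ R₁ R₂ : Query L) :
      (ys₁ ≠ [] ∨ ys₂ ≠ []) →
      zs₁.length = ys₁.length → zs₂.length = ys₂.length →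
      Variant (exs ys₁ Q₁) (exs zs₁ R₁) → Variant (exs ys₂ Q₂) (exs zs₂ R₂) →
      (∀ z ∈ zs₂, z ∉ R₁.freeVars) → (∀ z ∈ zs₁, z ∉ R₂.freeVars) →
      LocalRule (and (exs ys₁ Q₁) (exs ys₂ Q₂)) (exs zs₁ (exs zs₂ (and R₁ R₂)))
  | r10 (A : Query L) (s t : L.Term ℕ) : A.IsAtom →
      LocalRule (and A (eq s t)) (and (eq s t) A)
  | r11_left (Q : Query L) : LocalRule (and tt Q) Q
  | r11_right (Q : Query L) : LocalRule (and Q tt) Q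

/-- Steps (5)-(7). `BlockRule ys B B'` means that `(∃ ys) B` is replaced by `(∃ ys) B'`, where `B`
is a conjunction of equations and atoms only. -/
inductive BlockRule : List ℕ → Query L → Query L → Prop
  | r5 (ys : List ℕ) (Q₁ Q₂ : List (Query L)) (x : ℕ) (t : L.Term ℕ) :
      (∀ A ∈ Q₁ ++ Q₂, A.IsEquation ∨ A.IsAtom) →
      x ∉ t.varFinset → x ∉ ys → (∃ A ∈ Q₁ ++ Q₂, x ∈ A.freeVars) →
      BlockRule ys (conj (Q₁ ++ eq (FirstOrder.Language.Term.var x) t :: Q₂))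
        (conj (Q₁.map (subst x t) ++ eq (FirstOrder.Language.Term.var x) t :: Q₂.map (subst x t)))
  | r6 (ys : List ℕ) (Q₁ Q₂ : List (Query L)) (x : ℕ) (t : L.Term ℕ) :
      (∀ A ∈ Q₁ ++ Q₂, A.IsEquation ∨ A.IsAtom) →
      x ∉ t.varFinset → x ∈ ys →
      BlockRule ys (conj (Q₁ ++ eq (FirstOrder.Language.Term.var x) t :: Q₂))
        (conj (Q₁.map (subst x t) ++ tt :: Q₂.map (subst x t)))
  | r7 (ys : List ℕ) (Q₁ Q₂ : List (Query L)) (x : ℕ) (t : L.Term ℕ) :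
      (∀ A ∈ Q₁ ++ Q₂, A.IsEquation ∨ A.IsAtom) →
      ((∀ z, t ≠ FirstOrder.Language.Term.var z) ∨
        (∃ z, t = FirstOrder.Language.Term.var z ∧ z ≠ x ∧ z ∉ ys ∧ x ∈ ys)) →
      BlockRule ys (conj (Q₁ ++ eq t (FirstOrder.Language.Term.var x) :: Q₂))
        (conj (Q₁ ++ eq (FirstOrder.Language.Term.var x) t :: Q₂))

/-- A step (5)-(7) inside a query with quantifier prefix `ws`; the subquery `(∃ ys) B` that is
rewritten may use any final segment `ys` of the prefix `ws = xs ++ ys`. -/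
inductive BlockStep : List ℕ → Query L → Query L → Prop
  | intro (xs ys : List ℕ) (B B' : Query L) : BlockRule ys B B' →
      BlockStep (xs ++ ys) (exs (xs ++ ys) B) (exs (xs ++ ys) B')

/-- One of the steps (1)-(12), for fixed bracketing. The conjunction rewritten by (5)-(7) is never
a proper part of a longer conjunction: it is the whole query or stands directly under a
quantifier. -/
inductive Elementary : Query L → Query L → Prop
  | anywhere {Q Q' : Query L} : Everywhere LocalRule Q Q' → Elementary Q Q'
  | wholeBlock {Q Q' : Query L} (ws : List ℕ) : BlockStep ws Q Q' → Elementary Q Q'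
  | innerBlock {Q Q' : Query L} :
      Everywhere (fun P P' => ∃ ws, ws ≠ [] ∧ BlockStep ws P P') Q Q' → Elementary Q Q'
  | r12 (Q : Query L) : Q.HasFF → Elementary Q ff

/-- One step of the algorithm. Conjunctions are unbracketed, so steps are taken up to bracketing;
the algorithm stops as soon as `ff` has been returned. -/
def Step (Q Q' : Query L) : Prop :=
  Q ≠ ff ∧ ∃ P P', AssocEq Q P ∧ Elementary P P' ∧ AssocEq P' Q'

/-- `Q'` is an output of a run of the algorithm on the input `Q`. -/
def Output (Q Q' : Query L) : Prop :=
  Relation.ReflTransGen Step Q Q' ∧ (Q' = ff ∨ ¬ ∃ R, Step Q' R)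

/-- Solved form: `tt`, `ff`, or `(∃ z₁) … (∃ zₖ) (x₁ = s₁ ∧ … ∧ xₙ = sₙ ∧ A₁ ∧ … ∧ Aₘ)` with the
four usual conditions. -/
def InSolvedForm (Q : Query L) : Prop :=
  Q = tt ∨ Q = ff ∨
    ∃ (zs : List ℕ) (eqs : List (ℕ × L.Term ℕ)) (atoms : List (Query L)) (body : Query L),
      body = conj (eqs.map (fun e => eq (FirstOrder.Language.Term.var e.1) e.2) ++ atoms) ∧
      AssocEq Q (exs zs body) ∧
      (∀ A ∈ atoms, A.IsAtom) ∧
      (eqs.map Prod.fst ++ zs).Nodup ∧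
      (∀ x ∈ eqs.map Prod.fst,
        (∀ e ∈ eqs, x ∉ e.2.varFinset) ∧ (∀ A ∈ atoms, x ∉ A.freeVars)) ∧
      (∀ z ∈ zs, z ∈ body.freeVars) ∧
      (∀ z ∈ zs, ∀ e ∈ eqs, e.2 ≠ FirstOrder.Language.Term.var z)

end Syntactic

/-- An interpretation of all function symbols in the domain `D`. -/
abbrev PreInterp (L : FirstOrder.Language.{u, v}) (D : Type w) : Type (max u w) :=
  ∀ n : ℕ, L.Functions n → (Fin n → D) → D

/-- An interpretation of all predicate symbols in the domain `D`. -/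
abbrev Interp (L : FirstOrder.Language.{u, v}) (D : Type w) : Type (max v w) :=
  ∀ n : ℕ, L.Relations n → (Fin n → D) → Prop

section Semantic

variable {L : FirstOrder.Language.{u, v}} {D : Type w}

/-- The value of a term under the valuation `h`. -/
def eval (J : PreInterp L D) (h : ℕ → D) : L.Term ℕ → D
  | .var x => h x
  | .func f ts => J _ f (fun i => eval J h (ts i))

/-- `J` is a model of the free equality axioms. -/
structure IsFEAModel (J : PreInterp L D) : Prop where
  injective : ∀ (n : ℕ) (f : L.Functions n) (a b : Fin n → D),
    J n f a = J n f b ↔ ∀ i, a i = b i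
  disjoint : ∀ (n m : ℕ) (f : L.Functions n) (g : L.Functions m) (a : Fin n → D) (b : Fin m → D),
    (⟨n, f⟩ : Σ k, L.Functions k) ≠ ⟨m, g⟩ → J n f a ≠ J m g b
  acyclic : ∀ (h : ℕ → D) (x : ℕ) (t : L.Term ℕ),
    t ≠ FirstOrder.Language.Term.var x → x ∈ t.varFinset → h x ≠ eval J h t

/-- Truth of a query in a single interpretation, under the valuation `h`. -/
def Holds (J : PreInterp L D) (I : Interp L D) (h : ℕ → D) : Query L → Prop
  | .tt => True
  | .ff => False
  | .eq s t => eval J h s = eval J h t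
  | .atom p ts => I _ p (fun i => eval J h (ts i))
  | .and Q₁ Q₂ => Holds J I h Q₁ ∧ Holds J I h Q₂
  | .ex x Q => ∃ d, Holds J I (Function.update h x d) Q

/-- The solutions of a query in a multiinterpretation `Is`, a list of interpretations of length
`Q.card`: the `i`-th atom of `Q` is read in the `i`-th interpretation. -/
def solutions (J : PreInterp L D) : Query L → List (Interp L D) → Set (ℕ → D)
  | .tt, _ => Set.univ
  | .ff, _ => ∅
  | .eq s t, _ => {h | eval J h s = eval J h t}
  | .atom p ts, Is => {h | ∃ I ∈ Is.head?, I _ p (fun i => eval J h (ts i))}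
  | .and Q₁ Q₂, Is => solutions J Q₁ (Is.take Q₁.card) ∩ solutions J Q₂ (Is.drop Q₁.card)
  | .ex x Q, Is => {h | ∃ d, Function.update h x d ∈ solutions J Q Is}

/-- The relation `Q ≼_J Q'`. -/
def LeJ (J : PreInterp L D) (Q Q' : Query L) : Prop :=
  Q.card = Q'.card ∧
    ∀ Is : List (Interp L D), Is.length = Q.card → solutions J Q Is ⊆ solutions J Q' Is

end Semantic

section Equivalence

variable {L : FirstOrder.Language.{u, v}}

/-- `Q'` is more general than `Q`. The cardinality condition of `LeJ` is repeated, so that it does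
not depend on the existence of models. -/
def Le (Q Q' : Query L) : Prop :=
  Q.card = Q'.card ∧
    ∀ (D : Type w) [Nonempty D] (J : PreInterp L D), IsFEAModel J → LeJ J Q Q'

/-- Equivalence of queries in the multiinterpretation sense. -/
def Equivalent (Q Q' : Query L) : Prop := Le.{u, v, w} Q Q' ∧ Le.{u, v, w} Q' Q

/-- `Q` has no solution in any multiinterpretation for it over a model of the free equality
axioms. -/
def Unsolvable (Q : Query L) : Prop :=
  ∀ (D : Type w) [Nonempty D] (J : PreInterp L D), IsFEAModel J →
    ∀ Is : List (Interp L D), Is.length = Q.card → solutions J Q Is = ∅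

/-- `Q ↔ Q'` is a logical consequence of the free equality axioms. -/
def FEAEquivalent (Q Q' : Query L) : Prop :=
  ∀ (D : Type w) [Nonempty D] (J : PreInterp L D), IsFEAModel J →
    ∀ (I : Interp L D) (h : ℕ → D), Holds J I h Q ↔ Holds J I h Q'

end Equivalence

end ConjQuery

/-!
Each step other than (12) preserves, for a fixed valuation in a fixed model of the free equality
axioms, the truth value of the query when its atoms are read in the given sequence of
interpretations; (10) may exchange an atom with an equation because an equation reads no
interpretation. Step (12) starts from a query without solutions.

For termination, the steps decrease lexicographically the number of quantifiers, the number of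
pairs of parallel quantifiers, the weight standing beside quantifiers, and the sum of the ranks of
the maximal conjunctions of leaves. Step (8) decreases the first number and (9) the second or the
third. The rank of a conjunction counts first its unsolved variables: (5) solves `x`, (6) removes
it, and neither unsolves anything except possibly a variable `t`. It then accounts for the sizes of
the terms, the roles the variables play in equations (deeper bound variables first), the orientation
of the equations and the order of the conjuncts.

In a terminal query (9) has moved every quantifier to the front, and each of the other steps, being
inapplicable, contributes one clause of the definition of solved form.
-/

namespace ConjQuery

open FirstOrder.Language (Term)

variable {L : FirstOrder.Language.{u, v}}

/-! ### Terms, substitution and free variables -/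

theorem mem_varFinset_func {n : ℕ} {f : L.Functions n} {ts : Fin n → L.Term ℕ} {v : ℕ} :
    v ∈ (Term.func f ts).varFinset ↔ ∃ i, v ∈ (ts i).varFinset := by
  simp [Term.varFinset]

theorem mem_varFinset_var {v y : ℕ} : v ∈ (Term.var y : L.Term ℕ).varFinset ↔ v = y :=
  Finset.mem_singleton

theorem substTerm_var (x : ℕ) (t : L.Term ℕ) (y : ℕ) :
    substTerm x t (Term.var y) = if y = x then t else Term.var y := rfl

theorem substTerm_func (x : ℕ) (t : L.Term ℕ) {n : ℕ} (f : L.Functions n)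
    (ts : Fin n → L.Term ℕ) :
    substTerm x t (Term.func f ts) = Term.func f (fun i => substTerm x t (ts i)) := rfl

theorem mem_varFinset_substTerm {x v : ℕ} {t s : L.Term ℕ} :
    v ∈ (substTerm x t s).varFinset ↔
      (v ≠ x ∧ v ∈ s.varFinset) ∨ (x ∈ s.varFinset ∧ v ∈ t.varFinset) := by
  induction s with
  | var y =>
    rw [substTerm_var, mem_varFinset_var, mem_varFinset_var]
    by_cases h : y = x
    · subst h
      simp
    · grind [mem_varFinset_var]
  | func f ts ih =>
    simp only [substTerm_func, mem_varFinset_func, ih]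
    grind

theorem substTerm_of_notMem {x : ℕ} {t s : L.Term ℕ} (h : x ∉ s.varFinset) :
    substTerm x t s = s := by
  induction s with
  | var y => exact if_neg fun e => h (mem_varFinset_var.2 e.symm)
  | func f ts ih =>
    rw [substTerm_func]
    congr 1
    exact funext fun i => ih i fun hi => h (mem_varFinset_func.2 ⟨i, hi⟩)

namespace Query

theorem mem_freeVars_atom {n : ℕ} {p : L.Relations n} {ts : Fin n → L.Term ℕ} {v : ℕ} :
    v ∈ (atom p ts).freeVars ↔ ∃ i, v ∈ (ts i).varFinset := by
  simp [freeVars]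

theorem subst_of_notMem {x : ℕ} {t : L.Term ℕ} {Q : Query L} (h : x ∉ Q.freeVars) :
    Q.subst x t = Q := by
  induction Q with
  | tt => rfl
  | ff => rfl
  | eq s₁ s₂ =>
    simp only [freeVars, Finset.mem_union, not_or] at h
    simp only [subst, substTerm_of_notMem h.1, substTerm_of_notMem h.2]
  | atom p ts =>
    simp only [subst]
    congr 1
    exact funext fun i => substTerm_of_notMem fun hi => h (mem_freeVars_atom.2 ⟨i, hi⟩)
  | and P R ihP ihR =>
    simp only [freeVars, Finset.mem_union, not_or] at h
    simp only [subst, ihP h.1, ihR h.2]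
  | ex y P ih =>
    simp only [freeVars, Finset.mem_erase, not_and] at h
    simp only [subst, ite_eq_left_iff]
    exact fun e => by rw [ih (h (Ne.symm e))]

theorem card_subst (x : ℕ) (t : L.Term ℕ) (Q : Query L) : (Q.subst x t).card = Q.card := by
  induction Q with
  | and P R ihP ihR => simp only [subst, card, ihP, ihR]
  | ex y P ih =>
    simp only [subst]
    split_ifs <;> simp only [card, ih]
  | _ => rfl

theorem exs_append (ys zs : List ℕ) (Q : Query L) : exs (ys ++ zs) Q = exs ys (exs zs Q) :=
  List.foldr_append

theorem exs_cons (y : ℕ) (zs : List ℕ) (Q : Query L) : exs (y :: zs) Q = ex y (exs zs Q) := rfl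

theorem card_exs (ys : List ℕ) (Q : Query L) : (exs ys Q).card = Q.card := by
  induction ys with
  | nil => rfl
  | cons _ _ ih => exact ih

theorem mem_freeVars_exs {ys : List ℕ} {Q : Query L} {v : ℕ} :
    v ∈ (exs ys Q).freeVars ↔ v ∈ Q.freeVars ∧ v ∉ ys := by
  induction ys with
  | nil => simp [exs]
  | cons _ _ ih =>
    simp only [exs_cons, freeVars, Finset.mem_erase, ih, List.mem_cons, not_or]
    tauto

theorem conj_cons {Q : Query L} {l : List (Query L)} (h : l ≠ []) :
    conj (Q :: l) = and Q (conj l) := by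
  cases l with
  | nil => exact absurd rfl h
  | cons => rfl

theorem card_conj (l : List (Query L)) : (conj l).card = (l.map card).sum := by
  induction l with
  | nil => rfl
  | cons A l ih =>
    cases l with
    | nil => simp [conj]
    | cons => rw [conj_cons (List.cons_ne_nil _ _), card, ih, List.map_cons (a := A),
      List.sum_cons]

theorem card_conj_map_subst (x : ℕ) (t : L.Term ℕ) {l₁ l₂ : List (Query L)} {e e' : Query L}
    (he : e.card = e'.card) :
    (conj (l₁ ++ e :: l₂)).card = (conj (l₁.map (subst x t) ++ e' :: l₂.map (subst x t))).card := by
  simp [card_conj, Function.comp_def, card_subst, he]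

theorem substitutible_of_isEquation_or_isAtom {A : Query L} (h : A.IsEquation ∨ A.IsAtom)
    (x : ℕ) (t : L.Term ℕ) : A.Substitutible x t := by
  rcases h with ⟨s, t, rfl⟩ | ⟨n, p, ts, rfl⟩ <;> trivial

end Query

open Query

/-! ### Solutions -/

section Semantics

variable {D : Type w} {J : PreInterp L D}

theorem eval_congr {h h' : ℕ → D} {s : L.Term ℕ} (e : ∀ v ∈ s.varFinset, h v = h' v) :
    eval J h s = eval J h' s := by
  induction s with
  | var y => exact e y (mem_varFinset_var.2 rfl)
  | func f ts ih =>
    simp only [eval]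
    congr 1
    exact funext fun i => ih i fun v hv => e v (mem_varFinset_func.2 ⟨i, hv⟩)

theorem eval_update_of_notMem {h : ℕ → D} {x : ℕ} {d : D} {s : L.Term ℕ}
    (hx : x ∉ s.varFinset) : eval J (Function.update h x d) s = eval J h s :=
  eval_congr fun _ hv => Function.update_of_ne (ne_of_mem_of_not_mem hv hx) _ _

theorem eval_substTerm (h : ℕ → D) (x : ℕ) (t s : L.Term ℕ) :
    eval J h (substTerm x t s) = eval J (Function.update h x (eval J h t)) s := by
  induction s with
  | var y =>
    rw [substTerm_var]
    split_ifs with e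
    · subst e
      simp [eval]
    · simp [eval, e]
  | func f ts ih => simp only [substTerm_func, eval, ih]

theorem solutions_congr {Q : Query L} {Is : List (Interp L D)} {h h' : ℕ → D}
    (e : ∀ v ∈ Q.freeVars, h v = h' v) : h ∈ solutions J Q Is ↔ h' ∈ solutions J Q Is := by
  induction Q generalizing Is h h' with
  | tt => rfl
  | ff => rfl
  | eq s t =>
    simp only [freeVars, Finset.mem_union] at e
    simp only [solutions, Set.mem_ofPred_eq]
    rw [eval_congr fun v hv => e v (Or.inl hv), eval_congr fun v hv => e v (Or.inr hv)]
  | atom p ts =>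
    have ts_congr (i : Fin _) : eval J h (ts i) = eval J h' (ts i) :=
      eval_congr fun v hv => e v (mem_freeVars_atom.2 ⟨i, hv⟩)
    simp only [solutions, Set.mem_ofPred_eq, ts_congr]
  | and P R ihP ihR =>
    simp only [freeVars, Finset.mem_union] at e
    simp only [solutions, Set.mem_inter_iff]
    rw [ihP fun v hv => e v (Or.inl hv), ihR fun v hv => e v (Or.inr hv)]
  | ex y P ih =>
    simp only [freeVars, Finset.mem_erase] at e
    refine exists_congr fun d => ih fun v hv => ?_
    by_cases hvy : v = y
    · simp only [hvy, Function.update_self]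
    · simp only [Function.update_of_ne hvy, e v ⟨hvy, hv⟩]

theorem mem_solutions_update_of_notMem {Q : Query L} {Is : List (Interp L D)} {h : ℕ → D} {x : ℕ}
    {d : D} (hx : x ∉ Q.freeVars) :
    Function.update h x d ∈ solutions J Q Is ↔ h ∈ solutions J Q Is :=
  solutions_congr fun _ hv => Function.update_of_ne (ne_of_mem_of_not_mem hv hx) _ _

theorem mem_solutions_subst {Q : Query L} {Is : List (Interp L D)} {h : ℕ → D} {x : ℕ}
    {t : L.Term ℕ} (hs : Q.Substitutible x t) :
    h ∈ solutions J (Q.subst x t) Is ↔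
      Function.update h x (eval J h t) ∈ solutions J Q Is := by
  induction Q generalizing Is h with
  | tt => rfl
  | ff => rfl
  | eq s t => simp only [solutions, subst, eval_substTerm, Set.mem_ofPred_eq]
  | atom p ts => simp only [solutions, subst, eval_substTerm, Set.mem_ofPred_eq]
  | and P R ihP ihR =>
    simp only [solutions, subst, Set.mem_inter_iff, card_subst]
    rw [ihP hs.1, ihR hs.2]
  | ex y P ih =>
    by_cases hx : x ∈ (Query.ex y P).freeVars
    · obtain ⟨hy, hs⟩ := hs.resolve_left (not_not_intro hx)
      have hyx : y ≠ x := fun e => by simp [freeVars, e] at hx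
      simp only [subst, if_neg hyx, solutions, Set.mem_ofPred_eq]
      refine exists_congr fun d => ?_
      rw [ih hs, eval_update_of_notMem hy, Function.update_comm hyx]
    · rw [subst_of_notMem hx, mem_solutions_update_of_notMem hx]

theorem mem_solutions_exs {ys : List ℕ} {Q : Query L} {Is : List (Interp L D)} {h : ℕ → D} :
    h ∈ solutions J (exs ys Q) Is ↔
      ∃ h', (∀ v ∉ ys, h' v = h v) ∧ h' ∈ solutions J Q Is := by
  induction ys generalizing h with
  | nil => simp [exs, ← funext_iff]
  | cons y ys ih =>
    simp only [exs_cons, solutions, Set.mem_ofPred_eq, ih, List.mem_cons, not_or]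
    constructor
    · rintro ⟨d, h', e, hh⟩
      exact ⟨h', fun v hv => by rw [e v hv.2, Function.update_of_ne hv.1], hh⟩
    · rintro ⟨h', e, hh⟩
      refine ⟨h' y, h', fun v hv => ?_, hh⟩
      by_cases hvy : v = y
      · rw [hvy, Function.update_self]
      · rw [Function.update_of_ne hvy, e v ⟨hvy, hv⟩]

theorem solutions_exs_and {ys : List ℕ} {P R : Query L} (Is : List (Interp L D))
    (hy : ∀ y ∈ ys, y ∉ R.freeVars) :
    solutions J (and (exs ys P) R) Is = solutions J (exs ys (and P R)) Is := by
  ext h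
  have hR {h' : ℕ → D} (e : ∀ v ∉ ys, h' v = h v) (Is : List (Interp L D)) :
      h' ∈ solutions J R Is ↔ h ∈ solutions J R Is :=
    solutions_congr fun v hv => e v fun hvy => hy v hvy hv
  simp only [solutions, Set.mem_inter_iff, mem_solutions_exs, card_exs]
  grind

theorem solutions_and_exs {ys : List ℕ} {P R : Query L} (Is : List (Interp L D))
    (hy : ∀ y ∈ ys, y ∉ P.freeVars) :
    solutions J (and P (exs ys R)) Is = solutions J (exs ys (and P R)) Is := by
  ext h
  have hP {h' : ℕ → D} (e : ∀ v ∉ ys, h' v = h v) (Is : List (Interp L D)) :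
      h' ∈ solutions J P Is ↔ h ∈ solutions J P Is :=
    solutions_congr fun v hv => e v fun hvy => hy v hvy hv
  simp only [solutions, Set.mem_inter_iff, mem_solutions_exs]
  grind

theorem eval_eq_of_mem_solutions_conj {h : ℕ → D} {l : List (Query L)} {s t : L.Term ℕ}
    (hst : Query.eq s t ∈ l) {Is : List (Interp L D)} (hh : h ∈ solutions J (conj l) Is) :
    eval J h s = eval J h t := by
  induction l generalizing Is with
  | nil => simp at hst
  | cons A l ih =>
    cases l with
    | nil =>
      obtain rfl := List.mem_singleton.1 hst
      exact hh
    | cons =>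
      rcases List.mem_cons.1 hst with rfl | hst
      · exact hh.1
      · exact ih hst hh.2

theorem mem_solutions_conj_eqs {h : ℕ → D} (l : List (L.Term ℕ × L.Term ℕ))
    (Is : List (Interp L D)) :
    h ∈ solutions J (conj (l.map fun p => Query.eq p.1 p.2)) Is ↔
      ∀ p ∈ l, eval J h p.1 = eval J h p.2 := by
  induction l generalizing Is with
  | nil => simp [conj, solutions]
  | cons p l ih =>
    cases l with
    | nil => simp [conj, solutions]
    | cons q l =>
      rw [List.forall_mem_cons, ← ih (Is.drop 0)]
      rfl

theorem solutions_eq_empty_of_hasFF {Q : Query L} (h : Q.HasFF) (Is : List (Interp L D)) :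
    solutions J Q Is = ∅ := by
  induction Q generalizing Is with
  | ff => rfl
  | and P R ihP ihR => rcases h with h | h <;> simp [solutions, ihP, ihR, h]
  | ex x P ih => simp [solutions, ih h]
  | _ => exact h.elim

theorem mem_solutions_replicate {I : Interp L D} {h : ℕ → D} {Q : Query L} :
    h ∈ solutions J Q (List.replicate Q.card I) ↔ Holds J I h Q := by
  induction Q generalizing h with
  | and P R ihP ihR => simp [solutions, Holds, card, ihP, ihR]
  | ex x P ih => exact exists_congr fun d => ih
  | _ => simp [solutions, Holds, card]

/-- `h` solves `A` exactly when `h'` solves `A'`, in all multiinterpretations. Comparing two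
valuations makes the effect of a substitution a relation between the conjuncts of a block, and
this relation is compatible with conjunction. -/
def PointEquiv (J : PreInterp L D) (h h' : ℕ → D) (A A' : Query L) : Prop :=
  A.card = A'.card ∧ ∀ Is : List (Interp L D), Is.length = A.card →
    (h ∈ solutions J A Is ↔ h' ∈ solutions J A' Is)

theorem PointEquiv.refl (h : ℕ → D) (A : Query L) : PointEquiv J h h A A :=
  ⟨rfl, fun _ _ => Iff.rfl⟩

theorem PointEquiv.and {h h' : ℕ → D} {P P' R R' : Query L} (hP : PointEquiv J h h' P P')
    (hR : PointEquiv J h h' R R') : PointEquiv J h h' (Query.and P R) (Query.and P' R') := by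
  refine ⟨congrArg₂ _ hP.1 hR.1, fun Is hIs => ?_⟩
  rw [card] at hIs
  simp only [solutions, Set.mem_inter_iff, ← hP.1]
  rw [hP.2 _ (by simp; omega), hR.2 _ (by simp; omega)]

theorem PointEquiv.conj {h h' : ℕ → D} {l l' : List (Query L)}
    (hl : List.Forall₂ (PointEquiv J h h') l l') :
    PointEquiv J h h' (Query.conj l) (Query.conj l') := by
  induction hl with
  | nil => exact ⟨rfl, fun _ _ => Iff.rfl⟩
  | cons hA hl ih =>
    cases hl with
    | nil => exact hA
    | cons => exact hA.and ih

theorem PointEquiv.conj_map_cons_map {h h' : ℕ → D} {l₁ l₂ : List (Query L)} {e e' : Query L}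
    {g : Query L → Query L} (hg : ∀ A ∈ l₁ ++ l₂, PointEquiv J h h' A (g A))
    (he : PointEquiv J h h' e e') :
    PointEquiv J h h' (Query.conj (l₁ ++ e :: l₂)) (Query.conj (l₁.map g ++ e' :: l₂.map g)) := by
  rw [List.forall_mem_append] at hg
  refine PointEquiv.conj (List.rel_append ?_ (List.Forall₂.cons he ?_)) <;>
    rw [List.forall₂_map_right_iff, List.forall₂_same]
  exacts [hg.1, hg.2]

theorem PointEquiv.update_subst (h : ℕ → D) {A : Query L} {x : ℕ} {t : L.Term ℕ}
    (hs : A.Substitutible x t) :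
    PointEquiv J (Function.update h x (eval J h t)) h A (A.subst x t) :=
  ⟨(card_subst _ _ _).symm, fun _ _ => (mem_solutions_subst hs).symm⟩

theorem PointEquiv.subst {h : ℕ → D} {A : Query L} {x : ℕ} {t : L.Term ℕ}
    (hs : A.Substitutible x t) (hx : h x = eval J h t) : PointEquiv J h h A (A.subst x t) := by
  simpa only [← hx, Function.update_eq_self] using PointEquiv.update_subst (J := J) h hs

end Semantics

/-! ### Equivalence and soundness of the steps -/

theorem equivalent_iff {Q Q' : Query L} :
    Equivalent.{u, v, w} Q Q' ↔ Q.card = Q'.card ∧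
      ∀ (D : Type w) (J : PreInterp L D), IsFEAModel J → ∀ h, PointEquiv J h h Q Q' := by
  constructor
  · rintro ⟨⟨hc, h₁⟩, -, h₂⟩
    refine ⟨hc, fun D J hJ h => ⟨hc, fun Is hIs => ?_⟩⟩
    have : Nonempty D := ⟨h 0⟩
    exact ⟨fun hh => (h₁ D J hJ).2 Is hIs hh, fun hh => (h₂ D J hJ).2 Is (hIs.trans hc) hh⟩
  · rintro ⟨hc, H⟩
    exact ⟨⟨hc, fun D _ J hJ => ⟨hc, fun Is hIs h => ((H D J hJ h).2 Is hIs).1⟩⟩,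
      ⟨hc.symm, fun D _ J hJ => ⟨hc.symm, fun Is hIs h =>
        ((H D J hJ h).2 Is (hIs.trans hc.symm)).2⟩⟩⟩

namespace Equivalent

theorem of_mem_iff {Q Q' : Query L} (hc : Q.card = Q'.card)
    (H : ∀ (D : Type w) (J : PreInterp L D), IsFEAModel J → ∀ Is : List (Interp L D),
      Is.length = Q.card → ∀ h, h ∈ solutions J Q Is ↔ h ∈ solutions J Q' Is) :
    Equivalent.{u, v, w} Q Q' :=
  equivalent_iff.2 ⟨hc, fun D J hJ h => ⟨hc, fun Is hIs => H D J hJ Is hIs h⟩⟩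

theorem card_eq {Q Q' : Query L} (h : Equivalent.{u, v, w} Q Q') : Q.card = Q'.card := h.1.1

theorem mem_iff {Q Q' : Query L} (H : Equivalent.{u, v, w} Q Q') {D : Type w}
    {J : PreInterp L D} (hJ : IsFEAModel J) {Is : List (Interp L D)} (hIs : Is.length = Q.card)
    {h : ℕ → D} : h ∈ solutions J Q Is ↔ h ∈ solutions J Q' Is :=
  ((equivalent_iff.1 H).2 D J hJ h).2 Is hIs

theorem refl (Q : Query L) : Equivalent.{u, v, w} Q Q :=
  of_mem_iff rfl fun _ _ _ _ _ _ => Iff.rfl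

theorem symm {P Q : Query L} (h : Equivalent.{u, v, w} P Q) : Equivalent.{u, v, w} Q P :=
  And.symm h

theorem trans {P Q R : Query L} (h : Equivalent.{u, v, w} P Q)
    (h' : Equivalent.{u, v, w} Q R) : Equivalent.{u, v, w} P R :=
  of_mem_iff (h.card_eq.trans h'.card_eq) fun _ _ hJ _ hIs _ =>
    (h.mem_iff hJ hIs).trans (h'.mem_iff hJ (hIs.trans h.card_eq))

theorem and {P P' R R' : Query L} (hP : Equivalent.{u, v, w} P P')
    (hR : Equivalent.{u, v, w} R R') :
    Equivalent.{u, v, w} (Query.and P R) (Query.and P' R') := by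
  rw [equivalent_iff] at *
  exact ⟨congrArg₂ _ hP.1 hR.1, fun D J hJ h => (hP.2 D J hJ h).and (hR.2 D J hJ h)⟩

theorem ex (x : ℕ) {P P' : Query L} (hP : Equivalent.{u, v, w} P P') :
    Equivalent.{u, v, w} (Query.ex x P) (Query.ex x P') :=
  of_mem_iff hP.card_eq fun _ _ hJ _ hIs _ => exists_congr fun _ => hP.mem_iff hJ hIs

theorem exs (ys : List ℕ) {P P' : Query L} (hP : Equivalent.{u, v, w} P P') :
    Equivalent.{u, v, w} (Query.exs ys P) (Query.exs ys P') := by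
  induction ys with
  | nil => exact hP
  | cons y _ ih => exact ih.ex y

theorem conj {l l' : List (Query L)} (hl : List.Forall₂ Equivalent.{u, v, w} l l') :
    Equivalent.{u, v, w} (Query.conj l) (Query.conj l') := by
  induction hl with
  | nil => exact refl _
  | cons hA hl ih =>
    cases hl with
    | nil => exact hA
    | cons => exact hA.and ih

theorem of_everywhere {r : Query L → Query L → Prop}
    (hr : ∀ P P', r P P' → Equivalent.{u, v, w} P P') {P P' : Query L} (h : Everywhere r P P') :
    Equivalent.{u, v, w} P P' := by
  induction h with
  | here h => exact hr _ _ h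
  | andLeft R _ ih => exact ih.and (refl R)
  | andRight R _ ih => exact (refl R).and ih
  | ex x _ ih => exact ih.ex x

theorem and_assoc (P Q R : Query L) :
    Equivalent.{u, v, w} (Query.and (Query.and P Q) R) (Query.and P (Query.and Q R)) :=
  of_mem_iff (add_assoc _ _ _) fun D J _ Is _ h => by
    simp only [solutions, card, List.take_take, List.drop_take, List.drop_drop,
      Set.inter_assoc, Nat.add_sub_cancel_left, min_eq_left (Nat.le_add_right _ _)]

theorem of_assocEq {P P' : Query L} (h : AssocEq P P') : Equivalent.{u, v, w} P P' := by
  induction h with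
  | rel _ _ h => exact of_everywhere (fun _ _ ⟨P, Q, R⟩ => and_assoc P Q R) h
  | refl P => exact refl P
  | symm _ _ _ ih => exact ih.symm
  | trans _ _ _ _ _ ih ih' => exact ih.trans ih'

theorem ex_subst_var {x y : ℕ} {P : Query L} (hy : y ∉ P.freeVars)
    (hs : P.Substitutible x (Term.var y)) :
    Equivalent.{u, v, w} (Query.ex x P) (Query.ex y (P.subst x (Term.var y))) :=
  of_mem_iff (card_subst x _ P).symm fun D J _ Is _ h => by
    refine exists_congr fun d => ?_
    rw [mem_solutions_subst hs]
    refine solutions_congr fun v hv => ?_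
    have hvy : v ≠ y := ne_of_mem_of_not_mem hv hy
    by_cases hvx : v = x
    · simp [hvx, eval]
    · simp [hvx, hvy]

theorem of_variant {P P' : Query L} (h : Variant P P') : Equivalent.{u, v, w} P P' := by
  induction h with
  | refl => exact refl P
  | tail _ h ih =>
    exact ih.trans (of_everywhere (fun _ _ ⟨_, _, _, hy, hs⟩ => ex_subst_var hy hs) h)

theorem func_eq_func {n : ℕ} (f : L.Functions n) (s t : Fin n → L.Term ℕ) :
    Equivalent.{u, v, w} (Query.eq (Term.func f s) (Term.func f t))
      (Query.conj (List.ofFn fun i => Query.eq (s i) (t i))) := by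
  have map_eqs : (List.ofFn fun i => Query.eq (s i) (t i)) =
      (List.ofFn fun i => (s i, t i)).map fun p => Query.eq p.1 p.2 := by
    rw [List.map_ofFn, Function.comp_def]
  refine of_mem_iff ?_ fun D J hJ Is _ h => ?_
  · simp [card_conj, card, Function.comp_def]
  · rw [map_eqs, mem_solutions_conj_eqs]
    simp [solutions, eval, hJ.injective, List.mem_ofFn]

theorem func_eq_func_of_ne {n m : ℕ} {f : L.Functions n} {g : L.Functions m}
    (s : Fin n → L.Term ℕ) (t : Fin m → L.Term ℕ)
    (hfg : (⟨n, f⟩ : Σ k, L.Functions k) ≠ ⟨m, g⟩) :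
    Equivalent.{u, v, w} (Query.eq (Term.func f s) (Term.func g t)) ff :=
  of_mem_iff rfl fun _ _ hJ _ _ _ => iff_of_false (hJ.disjoint _ _ f g _ _ hfg) id

theorem var_eq_of_mem_varFinset {x : ℕ} {t : L.Term ℕ} (ht : t ≠ Term.var x)
    (hx : x ∈ t.varFinset) : Equivalent.{u, v, w} (Query.eq (Term.var x) t) ff :=
  of_mem_iff rfl fun _ _ hJ _ _ h => iff_of_false (hJ.acyclic h x t ht hx) id

theorem eq_self (t : L.Term ℕ) : Equivalent.{u, v, w} (Query.eq t t) tt :=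
  of_mem_iff rfl fun _ _ _ _ _ _ => iff_of_true rfl trivial

theorem eq_comm (s t : L.Term ℕ) : Equivalent.{u, v, w} (Query.eq s t) (Query.eq t s) :=
  of_mem_iff rfl fun _ _ _ _ _ _ => _root_.eq_comm

theorem ex_of_notMem {y : ℕ} {Q : Query L} (hy : y ∉ Q.freeVars) :
    Equivalent.{u, v, w} (Query.ex y Q) Q :=
  of_mem_iff rfl fun _ _ _ _ _ h =>
    (exists_congr fun _ => mem_solutions_update_of_notMem hy).trans
      ⟨fun ⟨_, hh⟩ => hh, fun hh => ⟨h y, hh⟩⟩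

theorem exs_and_exs {ys zs : List ℕ} {P R : Query L} (hz : ∀ z ∈ zs, z ∉ P.freeVars)
    (hy : ∀ y ∈ ys, y ∉ R.freeVars) :
    Equivalent.{u, v, w} (Query.and (Query.exs ys P) (Query.exs zs R))
      (Query.exs ys (Query.exs zs (Query.and P R))) := by
  have hy' : ∀ y ∈ ys, y ∉ (Query.exs zs R).freeVars := fun y hyys hyR =>
    hy y hyys (mem_freeVars_exs.1 hyR).1
  refine (of_mem_iff ?_ fun D J _ Is _ h => ?_).trans
    (.exs ys (of_mem_iff ?_ fun D J _ Is _ h => by rw [solutions_and_exs Is hz]))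
  · simp only [card, card_exs]
  · rw [solutions_exs_and Is hy']
  · simp only [card, card_exs]

theorem and_comm_of_card_eq_zero (P : Query L) {E : Query L} (hE : E.card = 0) :
    Equivalent.{u, v, w} (Query.and P E) (Query.and E P) :=
  of_mem_iff (add_comm _ _) fun D J _ Is hIs h => by
    have length_Is : Is.length = P.card := by simpa [card, hE] using hIs
    simp only [solutions, hE, List.drop_zero, ← length_Is, List.take_length, List.drop_length,
      List.take_zero, Set.inter_comm]

theorem tt_and (Q : Query L) : Equivalent.{u, v, w} (Query.and tt Q) Q :=
  of_mem_iff (zero_add _) fun D J _ Is _ h => by simp [solutions, card]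

theorem and_tt (Q : Query L) : Equivalent.{u, v, w} (Query.and Q tt) Q :=
  (and_comm_of_card_eq_zero Q rfl).trans (tt_and Q)

theorem of_localRule {P P' : Query L} (h : LocalRule P P') : Equivalent.{u, v, w} P P' := by
  cases h with
  | r1 f s t => exact func_eq_func f s t
  | r2 f g s t hfg => exact func_eq_func_of_ne s t hfg
  | r3 x t ht hx => exact var_eq_of_mem_varFinset ht hx
  | r4 x => exact eq_self _
  | r8 ys zs y Q hy =>
    rw [exs_append, exs_append, exs_cons]
    exact (ex_of_notMem hy).exs ys
  | r9 ys₁ ys₂ zs₁ zs₂ Q₁ Q₂ R₁ R₂ _ _ _ h₁ h₂ hz₂ hz₁ =>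
    exact ((of_variant h₁).and (of_variant h₂)).trans (exs_and_exs hz₂ hz₁)
  | r10 A s t _ => exact and_comm_of_card_eq_zero A rfl
  | r11_left => exact tt_and _
  | r11_right => exact and_tt _

section Block

variable {l₁ l₂ : List (Query L)} {x : ℕ} {t : L.Term ℕ}

theorem conj_subst (hl : ∀ A ∈ l₁ ++ l₂, A.Substitutible x t) :
    Equivalent.{u, v, w} (Query.conj (l₁ ++ Query.eq (Term.var x) t :: l₂))
      (Query.conj (l₁.map (subst x t) ++ Query.eq (Term.var x) t :: l₂.map (subst x t))) :=
  of_mem_iff (card_conj_map_subst x t rfl) fun D J _ Is hIs h => by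
    by_cases hx : h x = eval J h t
    · exact (PointEquiv.conj_map_cons_map (fun A hA => .subst (hl A hA) hx) (.refl h _)).2 Is hIs
    · have not_mem {m₁ m₂ : List (Query L)} :
          h ∉ solutions J (Query.conj (m₁ ++ Query.eq (Term.var x) t :: m₂)) Is := fun hh =>
        hx (eval_eq_of_mem_solutions_conj (s := Term.var x) (by simp) hh)
      exact iff_of_false not_mem not_mem

theorem exs_conj_eliminate {ys : List ℕ} (hl : ∀ A ∈ l₁ ++ l₂, A.Substitutible x t)
    (hxt : x ∉ t.varFinset) (hx : x ∈ ys) :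
    Equivalent.{u, v, w} (Query.exs ys (Query.conj (l₁ ++ Query.eq (Term.var x) t :: l₂)))
      (Query.exs ys (Query.conj (l₁.map (subst x t) ++ tt :: l₂.map (subst x t)))) := by
  refine of_mem_iff ?_ fun D J _ Is hIs h => ?_
  · rw [card_exs, card_exs]
    exact card_conj_map_subst x t rfl
  rw [card_exs] at hIs
  simp only [mem_solutions_exs]
  constructor
  · rintro ⟨h', e, hh⟩
    have h'x : h' x = eval J h' t :=
      eval_eq_of_mem_solutions_conj (s := Term.var x) (by simp) hh
    have eq_tt : PointEquiv J h' h' (Query.eq (Term.var x) t) tt :=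
      ⟨rfl, fun _ _ => iff_of_true h'x trivial⟩
    exact ⟨h', e, ((PointEquiv.conj_map_cons_map
      (fun A hA => .subst (hl A hA) h'x) eq_tt).2 Is hIs).1 hh⟩
  · rintro ⟨h', e, hh⟩
    have eq_tt : PointEquiv J (Function.update h' x (eval J h' t)) h'
        (Query.eq (Term.var x) t) tt :=
      ⟨rfl, fun _ _ => by simp [solutions, eval, eval_update_of_notMem hxt]⟩
    refine ⟨_, fun v hv => ?_, ((PointEquiv.conj_map_cons_map
      (fun A hA => .update_subst h' (hl A hA)) eq_tt).2 Is hIs).2 hh⟩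
    rw [Function.update_of_ne (ne_of_mem_of_not_mem hx hv).symm, e v hv]

theorem conj_eq_comm (s : L.Term ℕ) :
    Equivalent.{u, v, w} (Query.conj (l₁ ++ Query.eq s t :: l₂))
      (Query.conj (l₁ ++ Query.eq t s :: l₂)) :=
  .conj (List.rel_append (List.forall₂_same.2 fun A _ => refl A)
    (.cons (eq_comm s t) (List.forall₂_same.2 fun A _ => refl A)))

end Block

theorem of_blockRule {ys : List ℕ} {B B' : Query L} (h : BlockRule ys B B') :
    Equivalent.{u, v, w} (Query.exs ys B) (Query.exs ys B') := by
  cases h with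
  | r5 l₁ l₂ x t hl _ _ _ =>
    exact .exs ys (conj_subst fun A hA => substitutible_of_isEquation_or_isAtom (hl A hA) x t)
  | r6 l₁ l₂ x t hl hxt hx =>
    exact exs_conj_eliminate
      (fun A hA => substitutible_of_isEquation_or_isAtom (hl A hA) x t) hxt hx
  | r7 l₁ l₂ x t _ _ => exact .exs ys (conj_eq_comm t)

theorem of_blockStep {ws : List ℕ} {P P' : Query L} (h : BlockStep ws P P') :
    Equivalent.{u, v, w} P P' := by
  obtain ⟨xs, ys, B, B', h⟩ := h
  rw [exs_append, exs_append]
  exact (of_blockRule h).exs xs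

theorem unsolvable {Q Q' : Query L} (h : Equivalent.{u, v, w} Q Q')
    (hQ' : Unsolvable.{u, v, w} Q') : Unsolvable.{u, v, w} Q := fun D _ J hJ Is hIs =>
  Set.eq_empty_of_forall_notMem fun g hg => by
    rwa [h.mem_iff hJ hIs, hQ' D J hJ Is (hIs.trans h.card_eq)] at hg

theorem feaEquivalent {Q Q' : Query L} (h : Equivalent.{u, v, w} Q Q') :
    FEAEquivalent.{u, v, w} Q Q' := fun D _ J hJ I g => by
  rw [← mem_solutions_replicate, ← mem_solutions_replicate, ← h.card_eq]
  exact h.mem_iff hJ List.length_replicate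

end Equivalent

theorem unsolvable_of_hasFF {Q : Query L} (h : Q.HasFF) : Unsolvable.{u, v, w} Q :=
  fun _ _ _ _ Is _ => solutions_eq_empty_of_hasFF h Is

theorem Unsolvable.equivalent_ff {Q : Query L} (h : Unsolvable.{u, v, w} Q) (hQ : Q.card = 0) :
    Equivalent.{u, v, w} Q ff :=
  .of_mem_iff hQ fun D J hJ Is hIs g => by
    have : Nonempty D := ⟨g 0⟩
    rw [h D J hJ Is hIs]
    rfl

theorem Unsolvable.feaEquivalent_ff {Q : Query L} (h : Unsolvable.{u, v, w} Q) :
    FEAEquivalent.{u, v, w} Q ff := fun D _ J hJ I g => by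
  rw [← mem_solutions_replicate, h D J hJ _ List.length_replicate]
  rfl

theorem eq_iff_of_assocEq {c : Query L} (hc : c = tt ∨ c = ff) {P P' : Query L}
    (h : AssocEq P P') : P = c ↔ P' = c := by
  induction h with
  | rel _ _ h =>
    cases h with
    | here h =>
      obtain ⟨⟩ := h
      rcases hc with rfl | rfl <;> simp only [reduceCtorEq]
    | _ => rcases hc with rfl | rfl <;> simp only [reduceCtorEq]
  | refl => rfl
  | symm _ _ _ ih => exact ih.symm
  | trans _ _ _ _ _ ih ih' => exact ih.trans ih'

theorem Elementary.equivalent_or_hasFF {P P' : Query L} (h : Elementary P P') :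
    Equivalent.{u, v, w} P P' ∨ (P' = ff ∧ P.HasFF) := by
  cases h with
  | anywhere h => exact .inl (.of_everywhere (fun _ _ => .of_localRule) h)
  | wholeBlock ws h => exact .inl (.of_blockStep h)
  | innerBlock h => exact .inl (.of_everywhere (fun _ _ ⟨_, _, h⟩ => .of_blockStep h) h)
  | r12 h => exact .inr ⟨rfl, h⟩

theorem Step.equivalent_or_unsolvable {Q Q' : Query L} (h : Step Q Q') :
    Equivalent.{u, v, w} Q Q' ∨ (Q' = ff ∧ Unsolvable.{u, v, w} Q) := by
  obtain ⟨_, P, P', hP, h, hP'⟩ := h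
  rcases h.equivalent_or_hasFF with h | ⟨rfl, hff⟩
  · exact .inl (((Equivalent.of_assocEq hP).trans h).trans (.of_assocEq hP'))
  · exact .inr ⟨(eq_iff_of_assocEq (.inr rfl) hP').1 rfl,
      (Equivalent.of_assocEq hP).unsolvable (unsolvable_of_hasFF hff)⟩

theorem equivalent_or_unsolvable_of_reachable {Q Q' : Query L}
    (h : Relation.ReflTransGen Step Q Q') :
    Equivalent.{u, v, w} Q Q' ∨ (Q' = ff ∧ Unsolvable.{u, v, w} Q) := by
  induction h with
  | refl => exact .inl (.refl Q)
  | tail _ h ih =>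
    obtain ih := ih.resolve_right fun e => h.1 e.1
    exact h.equivalent_or_unsolvable.imp ih.trans (And.imp_right ih.unsolvable)
/-! ### Solved variables -/

/-- The variables that are free in some member of `A`. -/
def vars (A : Multiset (Query L)) : Finset ℕ := (A.bind fun q => q.freeVars.val).toFinset

/-- The number of members of `A` in which `v` is free. -/
def occ (A : Multiset (Query L)) (v : ℕ) : ℕ := A.countP fun q => v ∈ q.freeVars

/-- `q` is an equation with `x` as one side, and `x` does not occur in the other side. -/
def IsSide (q : Query L) (x : ℕ) : Prop :=
  ∃ t : L.Term ℕ, x ∉ t.varFinset ∧ (q = eq (Term.var x) t ∨ q = eq t (Term.var x))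

/-- `v` is solved in `A`: it is a side of an equation of `A` and has no other occurrence in `A`. -/
def IsSolved (A : Multiset (Query L)) (v : ℕ) : Prop := occ A v = 1 ∧ ∃ q ∈ A, IsSide q v

open Classical in
/-- The variables of `A` that are not solved. -/
noncomputable def unsolvedVars (A : Multiset (Query L)) : Finset ℕ :=
  (vars A).filter fun v => ¬ IsSolved A v

theorem mem_vars {A : Multiset (Query L)} {v : ℕ} : v ∈ vars A ↔ ∃ q ∈ A, v ∈ q.freeVars := by
  simp [vars]

theorem mem_vars_cons {q : Query L} {A : Multiset (Query L)} {v : ℕ} :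
    v ∈ vars (q ::ₘ A) ↔ v ∈ q.freeVars ∨ v ∈ vars A := by
  simp [mem_vars]

theorem mem_vars_add {A B : Multiset (Query L)} {v : ℕ} :
    v ∈ vars (A + B) ↔ v ∈ vars A ∨ v ∈ vars B := by
  simp [mem_vars, or_and_right, exists_or]

theorem occ_cons (q : Query L) (A : Multiset (Query L)) (v : ℕ) :
    occ (q ::ₘ A) v = occ A v + if v ∈ q.freeVars then 1 else 0 :=
  Multiset.countP_cons _ _ _

theorem occ_eq_zero {A : Multiset (Query L)} {v : ℕ} : occ A v = 0 ↔ v ∉ vars A := by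
  simp [occ, Multiset.countP_eq_zero, mem_vars]

theorem occ_cons_eq_one {q : Query L} {A : Multiset (Query L)} {v : ℕ} (hv : v ∈ q.freeVars) :
    occ (q ::ₘ A) v = 1 ↔ v ∉ vars A := by
  rw [occ_cons, if_pos hv, Nat.add_eq_right, occ_eq_zero]

theorem mem_unsolvedVars {A : Multiset (Query L)} {v : ℕ} :
    v ∈ unsolvedVars A ↔ v ∈ vars A ∧ ¬ IsSolved A v := by
  simp [unsolvedVars]

theorem IsSide.mem_freeVars {q : Query L} {x : ℕ} (h : IsSide q x) : x ∈ q.freeVars := by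
  obtain ⟨t, -, rfl | rfl⟩ := h <;> simp [freeVars]

theorem IsSide.subst {A : Query L} {x v : ℕ} {t : L.Term ℕ} (h : IsSide A v) (hvx : v ≠ x)
    (hvt : v ∉ t.varFinset) : IsSide (A.subst x t) v := by
  obtain ⟨s, hs, rfl | rfl⟩ := h <;>
    refine ⟨substTerm x t s, by rw [mem_varFinset_substTerm]; tauto, ?_⟩ <;>
    simp [Query.subst, substTerm_var, hvx]

theorem isSide_swap {s t : L.Term ℕ} {v : ℕ} : IsSide (eq s t) v ↔ IsSide (eq t s) v := by
  unfold IsSide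
  refine exists_congr fun r => and_congr_right fun _ => ?_
  simp only [eq.injEq]
  tauto

theorem isSolved_cons_of_isSide {q : Query L} {A : Multiset (Query L)} {v : ℕ} (hq : IsSide q v) :
    IsSolved (q ::ₘ A) v ↔ v ∉ vars A := by
  rw [IsSolved, occ_cons_eq_one hq.mem_freeVars]
  exact and_iff_left ⟨q, Multiset.mem_cons_self q A, hq⟩

theorem IsSolved.of_cons {q : Query L} {A : Multiset (Query L)} {v : ℕ}
    (h : IsSolved (q ::ₘ A) v) :
    (IsSide q v ∧ v ∉ vars A) ∨ (v ∉ q.freeVars ∧ IsSolved A v) := by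
  obtain ⟨h1, r, hr, hrv⟩ := h
  rcases Multiset.mem_cons.1 hr with rfl | hr
  · exact Or.inl ⟨hrv, (occ_cons_eq_one hrv.mem_freeVars).1 h1⟩
  · have hq : v ∉ q.freeVars := fun hq =>
      (occ_cons_eq_one hq).1 h1 (mem_vars.2 ⟨r, hr, hrv.mem_freeVars⟩)
    rw [occ_cons, if_neg hq] at h1
    exact Or.inr ⟨hq, h1, r, hr, hrv⟩

theorem IsSolved.add_of_notMem {A B : Multiset (Query L)} {v : ℕ} (h : IsSolved A v)
    (hv : v ∉ vars B) : IsSolved (B + A) v := by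
  obtain ⟨h1, q, hq, hqv⟩ := h
  refine ⟨?_, q, Multiset.mem_add.2 (Or.inr hq), hqv⟩
  rw [occ, Multiset.countP_add]
  exact (congrArg₂ _ (occ_eq_zero.2 hv) h1).trans (Nat.zero_add 1)

theorem vars_add_subset_vars_cons {e : Query L} {A M : Multiset (Query L)}
    (hA : vars A ⊆ e.freeVars) : vars (A + M) ⊆ vars (e ::ₘ M) := by
  intro v hv
  rw [mem_vars_cons]
  exact (mem_vars_add.1 hv).imp_left fun h => hA h

theorem unsolvedVars_add_subset {e : Query L} {A : Multiset (Query L)}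
    (he : ∀ x, ¬ IsSide e x) (hA : vars A ⊆ e.freeVars) (M : Multiset (Query L)) :
    unsolvedVars (A + M) ⊆ unsolvedVars (e ::ₘ M) := by
  intro v hv
  rw [mem_unsolvedVars] at hv ⊢
  refine ⟨vars_add_subset_vars_cons hA hv.1, fun h => hv.2 ?_⟩
  rcases h.of_cons with ⟨h, -⟩ | ⟨hve, h⟩
  · exact absurd h (he v)
  · exact h.add_of_notMem fun hvA => hve (hA hvA)

theorem vars_swap (s t : L.Term ℕ) (M : Multiset (Query L)) :
    vars (eq s t ::ₘ M) = vars (eq t s ::ₘ M) := by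
  ext v
  simp [mem_vars, freeVars, or_comm]

theorem occ_swap (s t : L.Term ℕ) (M : Multiset (Query L)) (v : ℕ) :
    occ (eq s t ::ₘ M) v = occ (eq t s ::ₘ M) v := by
  simp [occ_cons, freeVars, or_comm]

theorem unsolvedVars_swap (s t : L.Term ℕ) (M : Multiset (Query L)) :
    unsolvedVars (eq s t ::ₘ M) = unsolvedVars (eq t s ::ₘ M) := by
  ext v
  simp only [mem_unsolvedVars, vars_swap s t, IsSolved, occ_swap s t, Multiset.mem_cons,
    or_and_right, exists_or, exists_eq_left, isSide_swap (s := s)]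

/-! ### Substitution in a conjunction of equations and atoms -/

theorem mem_freeVars_subst {A : Query L} (hA : A.IsEquation ∨ A.IsAtom) {x v : ℕ}
    {t : L.Term ℕ} : v ∈ (A.subst x t).freeVars ↔
      (v ≠ x ∧ v ∈ A.freeVars) ∨ (x ∈ A.freeVars ∧ v ∈ t.varFinset) := by
  rcases hA with ⟨s, s', rfl⟩ | ⟨n, p, ts, rfl⟩
  · simp only [Query.subst, freeVars, Finset.mem_union, mem_varFinset_substTerm]
    tauto
  · simp only [Query.subst, mem_freeVars_atom, mem_varFinset_substTerm]
    grind

section Subst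

variable {M : Multiset (Query L)} {x : ℕ} {t : L.Term ℕ}

theorem mem_vars_map_subst (hM : ∀ A ∈ M, A.IsEquation ∨ A.IsAtom) {v : ℕ} :
    v ∈ vars (M.map (Query.subst x t)) ↔
      (v ≠ x ∧ v ∈ vars M) ∨ (x ∈ vars M ∧ v ∈ t.varFinset) := by
  simp only [mem_vars, Multiset.mem_map, exists_exists_and_eq_and]
  constructor
  · rintro ⟨A, hA, hv⟩
    rw [mem_freeVars_subst (hM A hA)] at hv
    exact hv.imp (fun h => ⟨h.1, A, hA, h.2⟩) fun h => ⟨⟨A, hA, h.1⟩, h.2⟩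
  · rintro (⟨hvx, A, hA, hv⟩ | ⟨⟨A, hA, hx⟩, hv⟩)
    · exact ⟨A, hA, (mem_freeVars_subst (hM A hA)).2 (Or.inl ⟨hvx, hv⟩)⟩
    · exact ⟨A, hA, (mem_freeVars_subst (hM A hA)).2 (Or.inr ⟨hx, hv⟩)⟩

theorem notMem_vars_map_subst (hM : ∀ A ∈ M, A.IsEquation ∨ A.IsAtom) (hxt : x ∉ t.varFinset) :
    x ∉ vars (M.map (Query.subst x t)) := by
  rw [mem_vars_map_subst hM]
  tauto

theorem map_subst_of_notMem (hx : x ∉ vars M) : M.map (Query.subst x t) = M := by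
  conv_rhs => rw [← Multiset.map_id' M]
  exact Multiset.map_congr rfl fun A hA =>
    Query.subst_of_notMem fun hxA => hx (mem_vars.2 ⟨A, hA, hxA⟩)

theorem occ_map_subst (hM : ∀ A ∈ M, A.IsEquation ∨ A.IsAtom) {v : ℕ} (hvx : v ≠ x)
    (hvt : v ∉ t.varFinset) : occ (M.map (Query.subst x t)) v = occ M v := by
  rw [occ, Multiset.countP_map, ← Multiset.countP_eq_card_filter]
  refine Multiset.countP_congr rfl fun A hA => ?_
  rw [mem_freeVars_subst (hM A hA), eq_iff_iff]
  tauto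

theorem IsSolved.map_subst (hM : ∀ A ∈ M, A.IsEquation ∨ A.IsAtom) {v : ℕ} (h : IsSolved M v)
    (hvx : v ≠ x) (hvt : v ∉ t.varFinset) : IsSolved (M.map (Query.subst x t)) v := by
  obtain ⟨h1, q, hq, hqv⟩ := h
  exact ⟨(occ_map_subst hM hvx hvt).trans h1, _, Multiset.mem_map_of_mem _ hq, hqv.subst hvx hvt⟩

variable {c : Query L}

theorem vars_cons_map_subst_subset (hM : ∀ A ∈ M, A.IsEquation ∨ A.IsAtom)
    (hc : c.freeVars ⊆ (eq (Term.var x) t).freeVars) :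
    vars (c ::ₘ M.map (Query.subst x t)) ⊆ vars (eq (Term.var x) t ::ₘ M) := by
  intro v hv
  simp only [mem_vars_cons, mem_vars_map_subst hM] at hv ⊢
  rcases hv with hv | hv | hv
  · exact Or.inl (hc hv)
  · exact Or.inr hv.2
  · exact Or.inl (Finset.mem_union_right _ hv.2)

/-- Substitution unsolves at most one variable `z`, namely if `t` is `z`. -/
theorem mem_unsolvedVars_of_subst (hM : ∀ A ∈ M, A.IsEquation ∨ A.IsAtom)
    (hc : c.freeVars ⊆ (eq (Term.var x) t).freeVars) {v : ℕ} (hvx : v ≠ x)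
    (hv : v ∈ unsolvedVars (c ::ₘ M.map (Query.subst x t))) :
    v ∈ unsolvedVars (eq (Term.var x) t ::ₘ M) ∨ (t = Term.var v ∧ v ∉ vars M) := by
  by_contra! hcon
  obtain ⟨hvars, hunsolved⟩ := mem_unsolvedVars.1 hv
  have hsolved : IsSolved (eq (Term.var x) t ::ₘ M) v := by
    by_contra h
    exact hcon.1 (mem_unsolvedVars.2 ⟨vars_cons_map_subst_subset hM hc hvars, h⟩)
  rcases hsolved.of_cons with ⟨⟨s, -, hs | hs⟩, hvM⟩ | ⟨hve, h⟩
  · simp only [eq.injEq, Term.var.injEq] at hs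
    exact hvx hs.1.symm
  · simp only [eq.injEq] at hs
    exact hvM (hcon.2 hs.2)
  · have hvt : v ∉ t.varFinset := fun h => hve (Finset.mem_union_right _ h)
    refine hunsolved ?_
    rw [← Multiset.singleton_add]
    exact (h.map_subst hM hvx hvt).add_of_notMem fun h => hve (hc (by simpa [mem_vars] using h))

theorem card_unsolvedVars_subst (hM : ∀ A ∈ M, A.IsEquation ∨ A.IsAtom) (hxt : x ∉ t.varFinset)
    (hc : c.freeVars ⊆ (eq (Term.var x) t).freeVars)
    (hxc : x ∉ unsolvedVars (c ::ₘ M.map (Query.subst x t))) (hx : x ∈ vars M) :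
    (unsolvedVars (c ::ₘ M.map (Query.subst x t))).card <
        (unsolvedVars (eq (Term.var x) t ::ₘ M)).card ∨
      ((unsolvedVars (c ::ₘ M.map (Query.subst x t))).card ≤
          (unsolvedVars (eq (Term.var x) t ::ₘ M)).card ∧
        ∃ z, t = Term.var z ∧ z ∉ vars M) := by
  have hxU : x ∈ unsolvedVars (eq (Term.var x) t ::ₘ M) := by
    rw [mem_unsolvedVars, isSolved_cons_of_isSide ⟨t, hxt, Or.inl rfl⟩, mem_vars_cons]
    exact ⟨Or.inr hx, not_not_intro hx⟩
  have hlt := Finset.card_erase_lt_of_mem hxU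
  have hsub : ∀ v ∈ unsolvedVars (c ::ₘ M.map (Query.subst x t)),
      v ∈ (unsolvedVars (eq (Term.var x) t ::ₘ M)).erase x ∨ (t = Term.var v ∧ v ∉ vars M) := by
    intro v hv
    have hvx : v ≠ x := fun h => hxc (h ▸ hv)
    exact (mem_unsolvedVars_of_subst hM hc hvx hv).imp_left fun h => Finset.mem_erase.2 ⟨hvx, h⟩
  by_cases hz : ∃ z, t = Term.var z ∧ z ∉ vars M
  · obtain ⟨z, rfl, hzM⟩ := hz
    refine Or.inr ⟨?_, z, rfl, hzM⟩
    have : unsolvedVars (c ::ₘ M.map (Query.subst x (Term.var z))) ⊆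
        insert z ((unsolvedVars (eq (Term.var x) (Term.var z) ::ₘ M)).erase x) := fun v hv =>
      Finset.mem_insert.2 ((hsub v hv).symm.imp_left fun h => (Term.var.inj h.1).symm)
    exact (Finset.card_le_card this).trans ((Finset.card_insert_le _ _).trans hlt)
  · exact Or.inl ((Finset.card_le_card fun v hv =>
      (hsub v hv).resolve_right fun h => hz ⟨v, h⟩).trans_lt hlt)

theorem card_unsolvedVars_subst_retain (hM : ∀ A ∈ M, A.IsEquation ∨ A.IsAtom)
    (hxt : x ∉ t.varFinset) (hx : x ∈ vars M) :
    (unsolvedVars (eq (Term.var x) t ::ₘ M.map (Query.subst x t))).card <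
        (unsolvedVars (eq (Term.var x) t ::ₘ M)).card ∨
      ((unsolvedVars (eq (Term.var x) t ::ₘ M.map (Query.subst x t))).card ≤
          (unsolvedVars (eq (Term.var x) t ::ₘ M)).card ∧
        ∃ z, t = Term.var z ∧ z ∉ vars M) := by
  refine card_unsolvedVars_subst hM hxt subset_rfl (fun h => (mem_unsolvedVars.1 h).2 ?_) hx
  exact (isSolved_cons_of_isSide ⟨t, hxt, Or.inl rfl⟩).2 (notMem_vars_map_subst hM hxt)

theorem card_unsolvedVars_subst_eliminate (hM : ∀ A ∈ M, A.IsEquation ∨ A.IsAtom)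
    (hxt : x ∉ t.varFinset) :
    (unsolvedVars (tt ::ₘ M.map (Query.subst x t))).card <
        (unsolvedVars (eq (Term.var x) t ::ₘ M)).card ∨
      ((unsolvedVars (tt ::ₘ M.map (Query.subst x t))).card ≤
          (unsolvedVars (eq (Term.var x) t ::ₘ M)).card ∧
        (x ∉ vars M ∨ ∃ z, t = Term.var z)) := by
  have hvars : ∀ {v}, v ∈ vars (tt ::ₘ M.map (Query.subst x t)) ↔
      v ∈ vars (M.map (Query.subst x t)) := by simp [mem_vars_cons, freeVars]
  have hx' : x ∉ unsolvedVars (tt ::ₘ M.map (Query.subst x t)) := fun h =>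
    notMem_vars_map_subst hM hxt (hvars.1 (mem_unsolvedVars.1 h).1)
  by_cases hx : x ∈ vars M
  · exact (card_unsolvedVars_subst hM hxt (Finset.empty_subset _) hx' hx).imp_right fun h =>
      ⟨h.1, Or.inr ⟨h.2.choose, h.2.choose_spec.1⟩⟩
  · refine Or.inr ⟨Finset.card_le_card fun v hv => ?_, Or.inl hx⟩
    have hvx : v ≠ x := fun h => hx' (h ▸ hv)
    refine (mem_unsolvedVars_of_subst hM (Finset.empty_subset _) hvx hv).resolve_right fun h => ?_
    have := hvars.1 (mem_unsolvedVars.1 hv).1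
    rw [map_subst_of_notMem hx] at this
    exact h.2 this

end Subst
/-! ### Weights -/

/-- A size of terms for which variables are strictly smaller than all other terms. -/
def termSize : L.Term ℕ → ℕ
  | .var _ => 1
  | .func _ ts => 2 + ∑ i, termSize (ts i)

/-- A weight of equations and atoms. The left-hand side of an equation counts twice, so that the
weight drops if a variable on the right is exchanged with a non-variable on the left. -/
def leafWeight : Query L → ℕ
  | .eq s t => 2 * termSize s + termSize t
  | _ => 1

/-- The sum of the weights of the members of `A`. -/
def weight (A : Multiset (Query L)) : ℕ := (A.map leafWeight).sum

theorem termSize_pos (t : L.Term ℕ) : 0 < termSize t := by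
  cases t <;> simp [termSize]

theorem leafWeight_pos (q : Query L) : 0 < leafWeight q := by
  cases q with
  | eq s t => exact Nat.add_pos_right _ (termSize_pos t)
  | _ => exact Nat.one_pos

theorem termSize_substTerm_var (x z : ℕ) (s : L.Term ℕ) :
    termSize (substTerm x (Term.var z) s) = termSize s := by
  induction s with
  | var y =>
    rw [substTerm_var]
    split_ifs <;> rfl
  | func f ts ih => simp only [substTerm_func, termSize, ih]

theorem leafWeight_subst_var (x z : ℕ) {A : Query L} (hA : A.IsEquation ∨ A.IsAtom) :
    leafWeight (A.subst x (Term.var z)) = leafWeight A := by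
  rcases hA with ⟨s, s', rfl⟩ | ⟨n, p, ts, rfl⟩
  · simp only [Query.subst, leafWeight, termSize_substTerm_var]
  · rfl

theorem weight_cons (q : Query L) (A : Multiset (Query L)) :
    weight (q ::ₘ A) = leafWeight q + weight A := by simp [weight]

theorem weight_add (A B : Multiset (Query L)) : weight (A + B) = weight A + weight B := by
  simp [weight]

theorem weight_map_subst_var {M : Multiset (Query L)} {x z : ℕ}
    (hM : ∀ A ∈ M, A.IsEquation ∨ A.IsAtom) :
    weight (M.map (Query.subst x (Term.var z))) = weight M := by
  rw [weight, Multiset.map_map, weight]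
  exact congrArg _ (Multiset.map_congr rfl fun A hA => leafWeight_subst_var x z (hM A hA))

/-! ### Orientation of equations between variables -/

/-- The depth of the innermost quantifier binding `v`, for the quantifier prefix `ws` listed from
the inside to the outside; it is `0` if `v` is not bound. -/
def depth (ws : List ℕ) (v : ℕ) : ℕ := ws.length - ws.idxOf v

open Classical in
/-- The number of equations `z = x` between variables with `x` bound inside the scope of `z`. -/
noncomputable def misoriented (ws : List ℕ) (A : Multiset (Query L)) : ℕ :=
  A.countP fun q => ∃ z x, q = eq (Term.var z) (Term.var x) ∧ depth ws z < depth ws x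

open Classical in
/-- The state of a variable: `1` if it is not isolated in `A`, `3` if it is isolated in a
misoriented equation on the left, `2` on the right of an equation between variables, and `0`
elsewhere. Reorienting `v = w` to `w = v`, followed by replacing the other occurrences of `w`, takes
`v` through `3`, `2`, `1`. -/
noncomputable def varState (ws : List ℕ) (A : Multiset (Query L)) (v : ℕ) : ℕ :=
  if occ A v ≠ 1 then 1
  else if ∃ w, depth ws v < depth ws w ∧ eq (Term.var v) (Term.var w) ∈ A then 3
  else if ∃ w, w ≠ v ∧ eq (Term.var w) (Term.var v) ∈ A then 2
  else 0

/-- The states of the variables, compared lexicographically with deeper variables first. -/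
noncomputable def stateWeight (ws : List ℕ) (A : Multiset (Query L)) : ℕ :=
  ∑ v ∈ vars A, varState ws A v * (3 * (vars A).card + 1) ^ depth ws v

theorem depth_lt_depth {ys rest : List ℕ} {x z : ℕ} (hx : x ∈ ys) (hz : z ∉ ys) :
    depth (ys.reverse ++ rest) z < depth (ys.reverse ++ rest) x := by
  rw [← List.mem_reverse] at hx hz
  have := List.idxOf_lt_length_of_mem hx
  simp only [depth, List.idxOf_append_of_mem hx, List.idxOf_append_of_notMem hz,
    List.length_append]
  omega

theorem sum_mul_pow_lt_sum_mul_pow {ι : Type*} {V : Finset ι} {d f g : ι → ℕ}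
    {b : ℕ} {p : ι} (hp : p ∈ V) (hlt : g p < f p) (hle : ∀ v ∈ V, d p ≤ d v → g v ≤ f v)
    (hg : ∀ v ∈ V, g v ≤ b) :
    ∑ v ∈ V, g v * (b * V.card + 1) ^ d v < ∑ v ∈ V, f v * (b * V.card + 1) ^ d v := by
  classical
  set K := b * V.card + 1 with hK
  obtain ⟨c, hc, hlow⟩ : ∃ c, V.card * c < K ^ d p ∧ ∀ v, d v < d p → b * K ^ d v ≤ c := by
    rcases Nat.eq_zero_or_pos (d p) with h0 | h0
    · exact ⟨0, by simp [h0], fun v hv => by omega⟩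
    · refine ⟨b * K ^ (d p - 1), ?_, fun v hv =>
        Nat.mul_le_mul_left _ (Nat.pow_le_pow_right (Nat.succ_pos _) (by omega))⟩
      calc V.card * (b * K ^ (d p - 1))
          < V.card * (b * K ^ (d p - 1)) + K ^ (d p - 1) :=
            Nat.lt_add_of_pos_right (Nat.pow_pos (Nat.succ_pos _))
        _ = K * K ^ (d p - 1) := by rw [hK]; ring
        _ = K ^ d p := by rw [← pow_succ', Nat.sub_add_cancel h0]
  have hrest : ∑ v ∈ V.erase p, g v * K ^ d v ≤ ∑ v ∈ V.erase p, f v * K ^ d v + V.card * c :=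
    calc ∑ v ∈ V.erase p, g v * K ^ d v
        ≤ ∑ v ∈ V.erase p, (f v * K ^ d v + c) := by
          refine Finset.sum_le_sum fun v hv => ?_
          have hvV := Finset.mem_of_mem_erase hv
          rcases Nat.lt_or_ge (d v) (d p) with h | h
          · exact le_add_of_nonneg_of_le (Nat.zero_le _)
              ((Nat.mul_le_mul_right _ (hg v hvV)).trans (hlow v h))
          · exact le_add_right (Nat.mul_le_mul_right _ (hle v hvV h))
      _ = ∑ v ∈ V.erase p, f v * K ^ d v + (V.erase p).card * c := by
          rw [Finset.sum_add_distrib, Finset.sum_const, smul_eq_mul]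
      _ ≤ _ := by
          gcongr
          exact Finset.erase_subset _ _
  have hfirst : g p * K ^ d p + K ^ d p ≤ f p * K ^ d p := by
    rw [← Nat.succ_mul]
    exact Nat.mul_le_mul_right _ hlt
  rw [← Finset.add_sum_erase V _ hp, ← Finset.add_sum_erase V (fun v => f v * K ^ d v) hp]
  omega

theorem varState_le_three (ws : List ℕ) (A : Multiset (Query L)) (v : ℕ) :
    varState ws A v ≤ 3 := by
  unfold varState
  split_ifs <;> simp

theorem stateWeight_lt_stateWeight {ws : List ℕ} {A A' : Multiset (Query L)} {p : ℕ}
    (hV : vars A' = vars A) (hp : p ∈ vars A) (hlt : varState ws A' p < varState ws A p)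
    (hle : ∀ v, depth ws p ≤ depth ws v → varState ws A' v ≤ varState ws A v) :
    stateWeight ws A' < stateWeight ws A := by
  unfold stateWeight
  rw [hV]
  exact sum_mul_pow_lt_sum_mul_pow hp hlt (fun v _ => hle v) fun v _ => varState_le_three ws A' v

theorem varState_le_varState {ws : List ℕ} {A A' : Multiset (Query L)} {v : ℕ}
    (hocc : occ A' v = occ A v)
    (hleft : ∀ w, depth ws v < depth ws w → eq (Term.var v) (Term.var w) ∈ A' →
      ∃ w, depth ws v < depth ws w ∧ eq (Term.var v) (Term.var w) ∈ A)
    (hright : ∀ w, w ≠ v → eq (Term.var w) (Term.var v) ∈ A' →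
      ∃ w, w ≠ v ∧ eq (Term.var w) (Term.var v) ∈ A) :
    varState ws A' v ≤ varState ws A v := by
  unfold varState
  rw [hocc]
  split_ifs <;> grind

theorem varState_of_occ_ne_one {ws : List ℕ} {A : Multiset (Query L)} {v : ℕ} (h : occ A v ≠ 1) :
    varState ws A v = 1 := if_pos h

section States

variable {ws : List ℕ} {M : Multiset (Query L)} {v w : ℕ}

theorem eq_var_left_notMem (hv : v ∉ vars M) (s : L.Term ℕ) : eq (Term.var v) s ∉ M := fun h =>
  hv (mem_vars.2 ⟨_, h, by simp [freeVars]⟩)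

theorem eq_var_right_notMem (hv : v ∉ vars M) (s : L.Term ℕ) : eq s (Term.var v) ∉ M := fun h =>
  hv (mem_vars.2 ⟨_, h, by simp [freeVars]⟩)

theorem varState_left_of_notMem (hv : v ∉ vars M) (hw : w ≠ v) :
    varState ws (eq (Term.var v) (Term.var w) ::ₘ M) v =
      if depth ws v < depth ws w then 3 else 0 := by
  have hocc : occ (eq (Term.var v) (Term.var w) ::ₘ M) v = 1 :=
    (occ_cons_eq_one (by simp [freeVars])).2 hv
  simp [varState, hocc, eq_var_left_notMem hv, eq_var_right_notMem hv, hw.symm]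

theorem varState_right_of_notMem (hv : v ∉ vars M) (hw : w ≠ v) :
    varState ws (eq (Term.var w) (Term.var v) ::ₘ M) v = 2 := by
  have hocc : occ (eq (Term.var w) (Term.var v) ::ₘ M) v = 1 :=
    (occ_cons_eq_one (by simp [freeVars])).2 hv
  simp [varState, hocc, eq_var_left_notMem hv, eq_var_right_notMem hv, hw]

variable {x z : ℕ}

theorem varState_swap_le (h : depth ws z < depth ws x) (v : ℕ) :
    varState ws (eq (Term.var x) (Term.var z) ::ₘ M) v ≤
      varState ws (eq (Term.var z) (Term.var x) ::ₘ M) v := by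
  have hzx : z ≠ x := fun e => h.ne (congrArg _ e)
  by_cases hv : v ∈ (eq (Term.var x) (Term.var z) : Query L).freeVars
  · by_cases hvM : v ∈ vars M
    · have hocc := mt (occ_cons_eq_one hv).1 (not_not_intro hvM)
      rw [varState_of_occ_ne_one hocc, varState_of_occ_ne_one (by rwa [occ_swap] at hocc)]
    · obtain rfl | rfl : v = x ∨ v = z := by simpa [freeVars] using hv
      · rw [varState_left_of_notMem hvM hzx, varState_right_of_notMem hvM hzx, if_neg h.not_gt]
        exact Nat.zero_le _
      · rw [varState_right_of_notMem hvM hzx.symm, varState_left_of_notMem hvM hzx.symm, if_pos h]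
        exact Nat.le_succ 2
  · have hv : v ≠ x ∧ v ≠ z := by simpa [freeVars, not_or] using hv
    refine varState_le_varState (occ_swap _ _ _ _) (fun w hw hm => ⟨w, hw, ?_⟩)
      fun w hw hm => ⟨w, hw, ?_⟩ <;> simpa [hv] using hm

theorem stateWeight_swap (h : depth ws z < depth ws x) :
    stateWeight ws (eq (Term.var x) (Term.var z) ::ₘ M) ≤
      stateWeight ws (eq (Term.var z) (Term.var x) ::ₘ M) := by
  unfold stateWeight
  rw [vars_swap (Term.var x)]
  exact Finset.sum_le_sum fun v _ => Nat.mul_le_mul_right _ (varState_swap_le h v)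

theorem misoriented_swap (h : depth ws z < depth ws x) :
    misoriented ws (eq (Term.var x) (Term.var z) ::ₘ M) <
      misoriented ws (eq (Term.var z) (Term.var x) ::ₘ M) := by
  simp [misoriented, h, h.not_gt]

theorem substTerm_var_eq_var {s : L.Term ℕ} (h : substTerm x (Term.var z) s = Term.var v) :
    (s = Term.var v ∧ v ≠ x) ∨ (s = Term.var x ∧ v = z) := by
  cases s with
  | var y =>
    rw [substTerm_var] at h
    split_ifs at h with hy
    · exact Or.inr ⟨congrArg _ hy, (Term.var.inj h).symm⟩
    · obtain rfl := Term.var.inj h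
      exact Or.inl ⟨rfl, hy⟩
  | func f ts => cases h

theorem exists_of_eq_var_mem_map_subst (hM : ∀ A ∈ M, A.IsEquation ∨ A.IsAtom)
    (h : eq (Term.var v) (Term.var w) ∈ M.map (Query.subst x (Term.var z))) :
    ∃ v' w', eq (Term.var v') (Term.var w') ∈ M ∧
      ((v' = v ∧ v ≠ x) ∨ (v' = x ∧ v = z)) ∧ ((w' = w ∧ w ≠ x) ∨ (w' = x ∧ w = z)) := by
  obtain ⟨A, hA, h⟩ := Multiset.mem_map.1 h
  rcases hM A hA with ⟨s, s', rfl⟩ | ⟨n, p, ts, rfl⟩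
  · obtain ⟨hs, hs'⟩ := Query.eq.inj h
    rcases substTerm_var_eq_var hs with ⟨rfl, h1⟩ | ⟨rfl, h1⟩ <;>
    rcases substTerm_var_eq_var hs' with ⟨rfl, h2⟩ | ⟨rfl, h2⟩ <;>
    exact ⟨_, _, hA, by simp [h1], by simp [h2]⟩
  · cases h

theorem vars_cons_map_subst_var (hM : ∀ A ∈ M, A.IsEquation ∨ A.IsAtom) :
    vars (eq (Term.var x) (Term.var z) ::ₘ M.map (Query.subst x (Term.var z))) =
      vars (eq (Term.var x) (Term.var z) ::ₘ M) := by
  refine (vars_cons_map_subst_subset hM subset_rfl).antisymm fun v hv => ?_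
  simp only [mem_vars_cons, mem_vars_map_subst hM, freeVars, Finset.mem_union,
    mem_varFinset_var] at hv ⊢
  tauto

theorem varState_subst_var_le (hM : ∀ A ∈ M, A.IsEquation ∨ A.IsAtom) (hvx : v ≠ x) (hvz : v ≠ z)
    (hd : ¬ (depth ws x < depth ws z ∧ depth ws v < depth ws z)) :
    varState ws (eq (Term.var x) (Term.var z) ::ₘ M.map (Query.subst x (Term.var z))) v ≤
      varState ws (eq (Term.var x) (Term.var z) ::ₘ M) v := by
  refine varState_le_varState ?_ (fun w hw hmem => ?_) fun w hw hmem => ?_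
  · rw [occ_cons, occ_cons, occ_map_subst hM hvx (mt mem_varFinset_var.1 hvz)]
  · have hsub := (Multiset.mem_cons.1 hmem).resolve_left (by simp [hvx])
    obtain ⟨v', w', hM', hv', hw'⟩ := exists_of_eq_var_mem_map_subst hM hsub
    obtain rfl : v' = v := by grind
    exact ⟨w', by grind, Multiset.mem_cons_of_mem hM'⟩
  · have hsub := (Multiset.mem_cons.1 hmem).resolve_left (by simp [hvz])
    obtain ⟨w', v', hM', hw', hv'⟩ := exists_of_eq_var_mem_map_subst hM hsub
    obtain rfl : v' = v := by grind
    exact ⟨w', by grind, Multiset.mem_cons_of_mem hM'⟩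

theorem stateWeight_subst_var (ws : List ℕ) (hM : ∀ A ∈ M, A.IsEquation ∨ A.IsAtom)
    (hx : x ∈ vars M) (hz : z ∉ vars M) :
    stateWeight ws (eq (Term.var x) (Term.var z) ::ₘ M.map (Query.subst x (Term.var z))) <
      stateWeight ws (eq (Term.var x) (Term.var z) ::ₘ M) := by
  set e : Query L := eq (Term.var x) (Term.var z) with he
  set M' := M.map (Query.subst x (Term.var z)) with hM'
  have hzx : z ≠ x := fun h => hz (h ▸ hx)
  have hxe : x ∈ e.freeVars := by simp [he, freeVars]
  have hze : z ∈ e.freeVars := by simp [he, freeVars]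
  have hzM' : z ∈ vars M' := (mem_vars_map_subst hM).2 (Or.inr ⟨hx, mem_varFinset_var.2 rfl⟩)
  have hxM' : x ∉ vars M' := notMem_vars_map_subst hM (mt mem_varFinset_var.1 hzx.symm)
  have hx_old : varState ws (e ::ₘ M) x = 1 :=
    varState_of_occ_ne_one (mt (occ_cons_eq_one hxe).1 (not_not_intro hx))
  have hx_new : varState ws (e ::ₘ M') x = if depth ws x < depth ws z then 3 else 0 :=
    varState_left_of_notMem hxM' hzx
  have hz_old : varState ws (e ::ₘ M) z = 2 := varState_right_of_notMem hz hzx.symm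
  have hz_new : varState ws (e ::ₘ M') z = 1 :=
    varState_of_occ_ne_one (mt (occ_cons_eq_one hze).1 (not_not_intro hzM'))
  by_cases hd : depth ws x < depth ws z
  · refine stateWeight_lt_stateWeight (vars_cons_map_subst_var hM) (p := z)
      (mem_vars_cons.2 (Or.inl hze)) (by omega) fun v hv => ?_
    by_cases hvz : v = z
    · subst hvz
      omega
    · exact varState_subst_var_le hM (fun h => by subst h; omega) hvz (by omega)
  · rw [if_neg hd] at hx_new
    refine stateWeight_lt_stateWeight (vars_cons_map_subst_var hM) (p := x)
      (mem_vars_cons.2 (Or.inl hxe)) (by omega) fun v _ => ?_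
    by_cases hvz : v = z
    · subst hvz
      omega
    · by_cases hvx : v = x
      · subst hvx
        omega
      · exact varState_subst_var_le hM hvx hvz (by omega)

end States

/-! ### The quantifier structure -/

namespace Query

/-- Queries that are neither conjunctions nor quantified. -/
def IsLeaf : Query L → Prop
  | and _ _ => False
  | ex _ _ => False
  | _ => True

/-- The number of quantifiers. -/
def quants : Query L → ℕ
  | and P R => P.quants + R.quants
  | ex _ P => P.quants + 1
  | _ => 0

/-- The number of pairs of quantifiers neither of which is in the scope of the other. -/
def parallel : Query L → ℕ
  | and P R => P.parallel + R.parallel + P.quants * R.quants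
  | ex _ P => P.parallel
  | _ => 0

/-- The leaves that are not in the scope of a quantifier, from left to right. -/
def openLeaves : Query L → List (Query L)
  | and P R => P.openLeaves ++ R.openLeaves
  | ex _ _ => []
  | q => [q]

/-- The total weight of the leaves that are not in the scope of a quantifier. -/
def openWeight (Q : Query L) : ℕ := weight (Q.openLeaves : Multiset (Query L))

/-- The sum, over all conjunctions, of the weight of the open leaves of one side times the number
of quantifiers of the other side. -/
def crossing : Query L → ℕ
  | and P R => P.crossing + R.crossing + P.openWeight * R.quants + R.openWeight * P.quants
  | ex _ P => P.crossing
  | _ => 0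

/-- The measures that depend neither on the names of the variables nor on the bracketing. -/
def shape (Q : Query L) : ℕ × ℕ × ℕ × ℕ := (Q.quants, Q.parallel, Q.openWeight, Q.crossing)

theorem isLeaf_of_isEquation_or_isAtom {A : Query L} (h : A.IsEquation ∨ A.IsAtom) : A.IsLeaf := by
  rcases h with ⟨s, t, rfl⟩ | ⟨n, p, ts, rfl⟩ <;> trivial

theorem IsLeaf.subst {A : Query L} (h : A.IsLeaf) (x : ℕ) (t : L.Term ℕ) :
    (A.subst x t).IsLeaf := by
  cases A with
  | and P R => exact h
  | ex y P => exact h.elim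
  | _ => trivial

theorem IsLeaf.openLeaves_eq {A : Query L} (h : A.IsLeaf) : A.openLeaves = [A] := by
  cases A with
  | and P R => exact h.elim
  | ex y P => exact h.elim
  | _ => rfl

theorem IsLeaf.quants_eq_zero {A : Query L} (h : A.IsLeaf) : A.quants = 0 := by
  cases A with
  | and P R => exact h.elim
  | ex y P => exact h.elim
  | _ => rfl

theorem openWeight_and (P R : Query L) : (and P R).openWeight = P.openWeight + R.openWeight := by
  rw [openWeight, openLeaves, ← Multiset.coe_add, weight_add]
  rfl

theorem openWeight_ex (x : ℕ) (P : Query L) : (ex x P).openWeight = 0 := rfl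

theorem openWeight_of_isLeaf {A : Query L} (h : A.IsLeaf) : A.openWeight = leafWeight A := by
  simp [openWeight, h.openLeaves_eq, weight]

@[elab_as_elim]
theorem quants_eq_zero_induction {motive : ∀ Q : Query L, Q.quants = 0 → Prop}
    (leaf : ∀ A (hA : A.IsLeaf), motive A hA.quants_eq_zero)
    (and : ∀ P R (hP : P.quants = 0) (hR : R.quants = 0), motive P hP → motive R hR →
      motive (and P R) (Nat.add_eq_zero_iff.2 ⟨hP, hR⟩))
    {Q : Query L} (h : Q.quants = 0) : motive Q h := by
  induction Q with
  | and P R ihP ihR =>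
    obtain ⟨hP, hR⟩ := Nat.add_eq_zero_iff.1 h
    exact and P R hP hR (ihP hP) (ihR hR)
  | ex x P => exact absurd h (Nat.succ_ne_zero _)
  | _ => exact leaf _ (by trivial)

theorem parallel_eq_zero {Q : Query L} (h : Q.quants = 0) : Q.parallel = 0 := by
  induction h using quants_eq_zero_induction with
  | leaf A hA => cases A <;> first | rfl | exact hA.elim
  | and P R hP _ ihP ihR => simp [parallel, hP, ihP, ihR]

theorem crossing_eq_zero {Q : Query L} (h : Q.quants = 0) : Q.crossing = 0 := by
  induction h using quants_eq_zero_induction with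
  | leaf A hA => cases A <;> first | rfl | exact hA.elim
  | and P R hP hR ihP ihR => simp [crossing, hP, hR, ihP, ihR]

theorem openWeight_pos {Q : Query L} (h : Q.quants = 0) : 0 < Q.openWeight := by
  induction h using quants_eq_zero_induction with
  | leaf A hA => exact openWeight_of_isLeaf hA ▸ leafWeight_pos A
  | and P R _ _ ihP _ => exact openWeight_and P R ▸ Nat.add_pos_left ihP _

theorem quants_exs (ys : List ℕ) (Q : Query L) : (exs ys Q).quants = Q.quants + ys.length := by
  induction ys with
  | nil => rfl
  | cons y ys ih => rw [exs_cons, quants, ih, List.length_cons, add_assoc]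

theorem parallel_exs (ys : List ℕ) (Q : Query L) : (exs ys Q).parallel = Q.parallel := by
  induction ys with
  | nil => rfl
  | cons _ _ ih => exact ih

theorem crossing_exs (ys : List ℕ) (Q : Query L) : (exs ys Q).crossing = Q.crossing := by
  induction ys with
  | nil => rfl
  | cons _ _ ih => exact ih

theorem openWeight_exs {ys : List ℕ} (h : ys ≠ []) (Q : Query L) : (exs ys Q).openWeight = 0 := by
  cases ys with
  | nil => exact absurd rfl h
  | cons y ys => rfl

theorem quants_conj {l : List (Query L)} (h : ∀ A ∈ l, A.IsLeaf) : (conj l).quants = 0 := by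
  induction l with
  | nil => rfl
  | cons A l ih =>
    obtain ⟨hA, hl⟩ := List.forall_mem_cons.1 h
    cases l with
    | nil => exact hA.quants_eq_zero
    | cons B l => rw [conj_cons (List.cons_ne_nil _ _), quants, hA.quants_eq_zero, ih hl]

theorem openLeaves_conj {l : List (Query L)} (hl : l ≠ []) (h : ∀ A ∈ l, A.IsLeaf) :
    (conj l).openLeaves = l := by
  induction l with
  | nil => exact absurd rfl hl
  | cons A l ih =>
    obtain ⟨hA, h⟩ := List.forall_mem_cons.1 h
    cases l with
    | nil => exact hA.openLeaves_eq
    | cons B l =>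
      rw [conj_cons (List.cons_ne_nil _ _), openLeaves, hA.openLeaves_eq,
        ih (List.cons_ne_nil _ _) h, List.singleton_append]

theorem shape_eq_iff {P P' : Query L} : P'.shape = P.shape ↔ P'.quants = P.quants ∧
    P'.parallel = P.parallel ∧ P'.openWeight = P.openWeight ∧ P'.crossing = P.crossing := by
  simp only [shape, Prod.mk.injEq]

theorem shape_and {P P' R R' : Query L} (hP : P'.shape = P.shape) (hR : R'.shape = R.shape) :
    (and P' R').shape = (and P R).shape := by
  rw [shape_eq_iff] at hP hR ⊢
  simp [quants, parallel, openWeight_and, crossing, hP, hR]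

theorem shape_ex (x y : ℕ) {P P' : Query L} (h : P'.shape = P.shape) :
    (ex y P').shape = (ex x P).shape := by
  rw [shape_eq_iff] at h ⊢
  simp [quants, parallel, openWeight_ex, crossing, h]

theorem shape_subst_var (x y : ℕ) (Q : Query L) : (Q.subst x (Term.var y)).shape = Q.shape := by
  induction Q with
  | and P R ihP ihR => exact shape_and ihP ihR
  | ex z P ih =>
    rw [subst]
    split_ifs
    · rfl
    · exact shape_ex z z ih
  | eq s t =>
    have he : IsLeaf (eq s t) := trivial
    refine shape_eq_iff.2 ⟨rfl, rfl, ?_, rfl⟩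
    rw [openWeight_of_isLeaf (he.subst _ _), openWeight_of_isLeaf he,
      leafWeight_subst_var x y (Or.inl ⟨s, t, rfl⟩)]
  | _ => rfl

end Query

theorem Everywhere.congr {α : Type*} {F : Query L → α} {r : Query L → Query L → Prop}
    (hr : ∀ P P', r P P' → F P' = F P)
    (hand : ∀ P P' R R', F P' = F P → F R' = F R → F (Query.and P' R') = F (Query.and P R))
    (hex : ∀ x P P', F P' = F P → F (Query.ex x P') = F (Query.ex x P)) {P P' : Query L}
    (h : Everywhere r P P') : F P' = F P := by
  induction h with
  | here h => exact hr _ _ h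
  | andLeft R _ ih => exact hand _ _ _ _ ih rfl
  | andRight R _ ih => exact hand _ _ _ _ rfl ih
  | ex x _ ih => exact hex x _ _ ih

theorem AssocEq.congr {α : Type*} {F : Query L → α}
    (hassoc : ∀ P Q R,
      F (Query.and P (Query.and Q R)) = F (Query.and (Query.and P Q) R))
    (hand : ∀ P P' R R', F P' = F P → F R' = F R → F (Query.and P' R') = F (Query.and P R))
    (hex : ∀ x P P', F P' = F P → F (Query.ex x P') = F (Query.ex x P)) {P P' : Query L}
    (h : AssocEq P P') : F P' = F P := by
  induction h with
  | rel _ _ h => exact h.congr (fun _ _ ⟨P, Q, R⟩ => hassoc P Q R) hand hex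
  | refl => rfl
  | symm _ _ _ ih => exact ih.symm
  | trans _ _ _ _ _ ih ih' => exact ih'.trans ih

theorem Variant.shape_eq {P P' : Query L} (h : Variant P P') : P'.shape = P.shape := by
  induction h with
  | refl => rfl
  | tail _ h ih =>
    refine Eq.trans (h.congr (fun _ _ h => ?_) (fun _ _ _ _ => shape_and)
      fun x _ _ => shape_ex x x) ih
    obtain ⟨x, y, G, -, -⟩ := h
    exact shape_ex x y (shape_subst_var x y G)

/-! ### Prenexing -/

/-- Quantifiers are moved out of conjunctions: there are fewer pairs of parallel quantifiers, or
else less weight stands beside quantifiers. -/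
structure Prenexes (P P' : Query L) : Prop where
  quants : P'.quants = P.quants
  openWeight : P'.openWeight ≤ P.openWeight
  parallel : P'.parallel < P.parallel ∨
    (P'.parallel = P.parallel ∧ P'.crossing < P.crossing)

namespace Prenexes

theorem andLeft (R : Query L) {P P' : Query L} (h : Prenexes P P') :
    Prenexes (Query.and P R) (Query.and P' R) := by
  have := Nat.mul_le_mul_right R.quants h.openWeight
  have := h.parallel
  have := h.openWeight
  constructor <;> simp only [Query.quants, Query.parallel, Query.openWeight_and, Query.crossing,
    h.quants] <;> omega

theorem andRight (R : Query L) {P P' : Query L} (h : Prenexes P P') :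
    Prenexes (Query.and R P) (Query.and R P') := by
  have := Nat.mul_le_mul_right R.quants h.openWeight
  have := h.parallel
  have := h.openWeight
  constructor <;> simp only [Query.quants, Query.parallel, Query.openWeight_and, Query.crossing,
    h.quants] <;> omega

theorem ex (x : ℕ) {P P' : Query L} (h : Prenexes P P') :
    Prenexes (Query.ex x P) (Query.ex x P') :=
  ⟨congrArg (· + 1) h.quants, le_rfl, h.parallel⟩

theorem of_shape_eq {P P₁ P' : Query L} (h : Prenexes P P') (hs : P.shape = P₁.shape) :
    Prenexes P₁ P' := by
  rw [shape_eq_iff] at hs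
  exact ⟨h.quants.trans hs.1, h.openWeight.trans_eq hs.2.2.1, by simpa [hs] using h.parallel⟩

theorem exs {zs₁ zs₂ : List ℕ} (h : zs₁ ≠ [] ∨ zs₂ ≠ []) (R₁ R₂ : Query L) :
    Prenexes (Query.and (Query.exs zs₁ R₁) (Query.exs zs₂ R₂))
      (Query.exs zs₁ (Query.exs zs₂ (Query.and R₁ R₂))) := by
  refine ⟨by simp only [quants_exs, Query.quants]; omega, ?_, ?_⟩
  · rw [← exs_append, openWeight_exs (by simpa [or_iff_not_imp_left] using h)]
    exact Nat.zero_le _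
  simp only [parallel_exs, crossing_exs, Query.parallel, Query.crossing, quants_exs]
  set k₁ := zs₁.length
  set k₂ := zs₂.length
  set q₁ := R₁.quants
  set q₂ := R₂.quants
  have hk : 0 < k₁ ∨ 0 < k₂ := by simpa only [k₁, k₂, List.length_pos_iff] using h
  have hmul : (q₁ + k₁) * (q₂ + k₂) = q₁ * q₂ + q₁ * k₂ + k₁ * (q₂ + k₂) := by ring
  by_cases hpar : q₁ * k₂ + k₁ * (q₂ + k₂) = 0
  · right
    simp only [Nat.add_eq_zero_iff, Nat.mul_eq_zero] at hpar
    rcases hk with hk | hk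
    · have hq₂ : q₂ = 0 := by omega
      have hk₂ : k₂ = 0 := by omega
      have := Nat.mul_pos (openWeight_pos hq₂) hk
      simp only [List.length_eq_zero_iff.1 hk₂, hq₂, hk₂, Query.exs, List.foldr_nil, mul_add]
      omega
    · have hq₁ : q₁ = 0 := by omega
      have hk₁ : k₁ = 0 := by omega
      have := Nat.mul_pos (openWeight_pos hq₁) hk
      simp only [List.length_eq_zero_iff.1 hk₁, hq₁, hk₁, Query.exs, List.foldr_nil, mul_add]
      omega
  · left
    omega

end Prenexes

/-! ### The rank of a block -/

open Classical in
/-- The number of pairs of an atom and an equation to the right of it. -/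
noncomputable def inversions : List (Query L) → ℕ
  | [] => 0
  | A :: l => (if A.IsAtom then l.countP fun q => q.IsEquation else 0) + inversions l

theorem inversions_swap_lt {A E : Query L} (hA : A.IsAtom) (hE : E.IsEquation)
    (l r : List (Query L)) : inversions (l ++ E :: A :: r) < inversions (l ++ A :: E :: r) := by
  induction l with
  | nil =>
    have hEA : ¬ E.IsAtom := by
      obtain ⟨s, t, rfl⟩ := hE
      rintro ⟨n, p, ts, h⟩
      cases h
    simp [inversions, hA, hE, hEA]
  | cons B l ih =>
    have hperm : (l ++ E :: A :: r).Perm (l ++ A :: E :: r) := (List.Perm.swap A E r).append_left l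
    simpa only [inversions, List.cons_append, hperm.countP_eq] using Nat.add_lt_add_left ih _

/-- The termination measure of the conjunction of `l` in the scope of the variables `ws`, innermost
first. -/
noncomputable def blockRank (ws : List ℕ) (l : List (Query L)) : ℕ ×ₗ ℕ ×ₗ ℕ ×ₗ ℕ ×ₗ ℕ :=
  let A : Multiset (Query L) := l
  toLex ((unsolvedVars A).card, toLex (weight A,
    toLex (stateWeight ws A, toLex (misoriented ws A, inversions l))))

theorem blockRank_lt_of_weight {ws : List ℕ} {l l' : List (Query L)}
    (hu : (unsolvedVars (l' : Multiset (Query L))).card ≤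
      (unsolvedVars (l : Multiset (Query L))).card)
    (hw : weight (l' : Multiset (Query L)) < weight (l : Multiset (Query L))) :
    blockRank ws l' < blockRank ws l := by
  simp only [blockRank, Prod.Lex.toLex_lt_toLex]
  omega

theorem blockRank_replace_lt {e : Query L} {A : List (Query L)} (he : ∀ x, ¬ IsSide e x)
    (hv : vars (A : Multiset (Query L)) ⊆ e.freeVars)
    (hw : weight (A : Multiset (Query L)) < leafWeight e) (ws : List ℕ) (l r : List (Query L)) :
    blockRank ws (l ++ A ++ r) < blockRank ws (l ++ e :: r) := by
  have hA : ((l ++ A ++ r : List (Query L)) : Multiset (Query L)) = A + (l ++ r : List (Query L)) :=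
    Multiset.coe_eq_coe.2 (by simpa using List.perm_append_comm.append_right r)
  have hl : ((l ++ e :: r : List (Query L)) : Multiset (Query L)) =
      e ::ₘ (l ++ r : List (Query L)) := Multiset.coe_eq_coe.2 List.perm_middle
  refine blockRank_lt_of_weight ?_ ?_ <;> rw [hA, hl]
  · exact Finset.card_le_card (unsolvedVars_add_subset he hv _)
  · rw [weight_add, weight_cons]
    exact Nat.add_lt_add_right hw _

theorem blockRank_swap_lt {A E : Query L} (hA : A.IsAtom) (hE : E.IsEquation) (ws : List ℕ)
    (l r : List (Query L)) : blockRank ws (l ++ E :: A :: r) < blockRank ws (l ++ A :: E :: r) := by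
  have hperm : ((l ++ E :: A :: r : List (Query L)) : Multiset (Query L)) =
      (l ++ A :: E :: r : List (Query L)) :=
    Multiset.coe_eq_coe.2 ((List.Perm.swap A E r).append_left l)
  simpa only [blockRank, hperm, Prod.Lex.toLex_lt_toLex, lt_irrefl, true_and, false_or] using
    inversions_swap_lt hA hE l r

section BlockRule

variable {l₁ l₂ : List (Query L)} {x : ℕ} {t : L.Term ℕ}

theorem coe_append_cons (e : Query L) :
    ((l₁ ++ e :: l₂ : List (Query L)) : Multiset (Query L)) = e ::ₘ (l₁ ++ l₂ : List (Query L)) :=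
  Multiset.coe_eq_coe.2 List.perm_middle

theorem coe_map_append_cons_map (f : Query L → Query L) (e : Query L) :
    ((l₁.map f ++ e :: l₂.map f : List (Query L)) : Multiset (Query L)) =
      e ::ₘ Multiset.map f (l₁ ++ l₂ : List (Query L)) := by
  rw [coe_append_cons, ← List.map_append, Multiset.map_coe]

theorem blockRank_subst_lt (hl : ∀ A ∈ l₁ ++ l₂, A.IsEquation ∨ A.IsAtom) (hxt : x ∉ t.varFinset)
    (hx : ∃ A ∈ l₁ ++ l₂, x ∈ A.freeVars) (ws : List ℕ) :
    blockRank ws (l₁.map (subst x t) ++ eq (Term.var x) t :: l₂.map (subst x t)) <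
      blockRank ws (l₁ ++ eq (Term.var x) t :: l₂) := by
  replace hl : ∀ A ∈ ((l₁ ++ l₂ : List (Query L)) : Multiset (Query L)), _ := hl
  replace hx : x ∈ vars ((l₁ ++ l₂ : List (Query L)) : Multiset (Query L)) := mem_vars.2 hx
  rw [blockRank, blockRank, coe_map_append_cons_map, coe_append_cons]
  simp only [Prod.Lex.toLex_lt_toLex]
  generalize ((l₁ ++ l₂ : List (Query L)) : Multiset (Query L)) = M at hl hx ⊢
  rcases card_unsolvedVars_subst_retain hl hxt hx with h | ⟨h, z, rfl, hz⟩
  · exact Or.inl h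
  · have := stateWeight_subst_var ws hl hx hz
    rw [weight_cons, weight_cons, weight_map_subst_var hl]
    omega

theorem blockRank_eliminate_lt (hl : ∀ A ∈ l₁ ++ l₂, A.IsEquation ∨ A.IsAtom)
    (hxt : x ∉ t.varFinset) (ws : List ℕ) :
    blockRank ws (l₁.map (subst x t) ++ tt :: l₂.map (subst x t)) <
      blockRank ws (l₁ ++ eq (Term.var x) t :: l₂) := by
  replace hl : ∀ A ∈ ((l₁ ++ l₂ : List (Query L)) : Multiset (Query L)), _ := hl
  rw [blockRank, blockRank, coe_map_append_cons_map, coe_append_cons]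
  simp only [Prod.Lex.toLex_lt_toLex]
  generalize ((l₁ ++ l₂ : List (Query L)) : Multiset (Query L)) = M at hl ⊢
  rcases card_unsolvedVars_subst_eliminate hl hxt with h | ⟨h, hx⟩
  · exact Or.inl h
  · have hw : weight (M.map (subst x t)) = weight M := by
      rcases hx with hx | ⟨z, rfl⟩
      · rw [map_subst_of_notMem hx]
      · exact weight_map_subst_var hl
    have := termSize_pos t
    simp only [weight_cons, hw, leafWeight, termSize]
    omega

theorem blockRank_swap_sides_lt {ws : List ℕ}
    (h : ∀ z, t = Term.var z → depth ws z < depth ws x) :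
    blockRank ws (l₁ ++ eq (Term.var x) t :: l₂) <
      blockRank ws (l₁ ++ eq t (Term.var x) :: l₂) := by
  simp only [blockRank, coe_append_cons, Prod.Lex.toLex_lt_toLex, weight_cons,
    unsolvedVars_swap t (Term.var x), leafWeight, true_and]
  cases t with
  | func f ts =>
    simp only [termSize]
    omega
  | var z =>
    have hd := h z rfl
    have := stateWeight_swap (M := ((l₁ ++ l₂ : List (Query L)) : Multiset (Query L))) hd
    have := misoriented_swap (M := ((l₁ ++ l₂ : List (Query L)) : Multiset (Query L))) hd
    simp only [termSize, true_and]
    omega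

theorem isLeaf_of_mem_append_cons {e : Query L} (he : e.IsLeaf) (hl : ∀ A ∈ l₁ ++ l₂, A.IsLeaf) :
    ∀ A ∈ l₁ ++ e :: l₂, A.IsLeaf := by
  simp only [List.mem_append, List.mem_cons] at hl ⊢
  rintro A (hA | rfl | hA)
  exacts [hl A (Or.inl hA), he, hl A (Or.inr hA)]

theorem isLeaf_of_mem_map_subst (hl : ∀ A ∈ l₁ ++ l₂, A.IsLeaf) :
    ∀ A ∈ l₁.map (subst x t) ++ l₂.map (subst x t), A.IsLeaf := by
  rw [← List.map_append]
  exact List.forall_mem_map.2 fun A hA => (hl A hA).subst x t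

theorem BlockRule.exists_blockRank_lt {ys : List ℕ} {B B' : Query L} (h : BlockRule ys B B') :
    ∃ l l' : List (Query L), B = conj l ∧ B' = conj l' ∧ l ≠ [] ∧ l' ≠ [] ∧
      (∀ A ∈ l, A.IsLeaf) ∧ (∀ A ∈ l', A.IsLeaf) ∧
      ∀ rest, blockRank (ys.reverse ++ rest) l' < blockRank (ys.reverse ++ rest) l := by
  have hleaf : ∀ {l : List (Query L)}, (∀ A ∈ l, A.IsEquation ∨ A.IsAtom) → ∀ A ∈ l, A.IsLeaf :=
    fun hl A hA => isLeaf_of_isEquation_or_isAtom (hl A hA)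
  cases h with
  | r5 l₁ l₂ x t hl hxt _ hx =>
    exact ⟨_, _, rfl, rfl, by simp, by simp, isLeaf_of_mem_append_cons trivial (hleaf hl),
      isLeaf_of_mem_append_cons trivial (isLeaf_of_mem_map_subst (hleaf hl)),
      fun rest => blockRank_subst_lt hl hxt hx _⟩
  | r6 l₁ l₂ x t hl hxt _ =>
    exact ⟨_, _, rfl, rfl, by simp, by simp, isLeaf_of_mem_append_cons trivial (hleaf hl),
      isLeaf_of_mem_append_cons trivial (isLeaf_of_mem_map_subst (hleaf hl)),
      fun rest => blockRank_eliminate_lt hl hxt _⟩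
  | r7 l₁ l₂ x t hl hx =>
    refine ⟨_, _, rfl, rfl, by simp, by simp, isLeaf_of_mem_append_cons trivial (hleaf hl),
      isLeaf_of_mem_append_cons trivial (hleaf hl),
      fun rest => blockRank_swap_sides_lt fun z hz => ?_⟩
    rcases hx with hx | ⟨z', h, -, hz', hx⟩
    · exact absurd hz (hx z)
    · obtain rfl := Term.var.inj (hz.symm.trans h)
      exact depth_lt_depth hx hz'

end BlockRule

/-! ### The rank of a query -/

/-- The sum of the ranks of the blocks standing under the quantifiers of a query that itself is in
the scope of the variables `ws`. -/
noncomputable def innerRank : List ℕ → Query L → ℕ ×ₗ ℕ ×ₗ ℕ ×ₗ ℕ ×ₗ ℕ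
  | ws, .and P R => innerRank ws P + innerRank ws R
  | ws, .ex x P => blockRank (x :: ws) P.openLeaves + innerRank (x :: ws) P
  | _, _ => 0

/-- The sum of the ranks of all blocks of a query in the scope of the variables `ws`. -/
noncomputable def fullRank (ws : List ℕ) (Q : Query L) : ℕ ×ₗ ℕ ×ₗ ℕ ×ₗ ℕ ×ₗ ℕ :=
  blockRank ws Q.openLeaves + innerRank ws Q

/-- The termination measure of the algorithm. -/
noncomputable def rank (Q : Query L) : ℕ ×ₗ ℕ ×ₗ ℕ ×ₗ ℕ ×ₗ ℕ ×ₗ ℕ ×ₗ ℕ ×ₗ ℕ :=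
  toLex (Q.quants, toLex (Q.parallel, toLex (Q.crossing, fullRank [] Q)))

theorem innerRank_eq_zero {Q : Query L} (h : Q.quants = 0) (ws : List ℕ) : innerRank ws Q = 0 := by
  induction h using quants_eq_zero_induction with
  | leaf A hA =>
    cases A with
    | and P R => exact hA.elim
    | ex x P => exact hA.elim
    | _ => rfl
  | and P R _ _ ihP ihR => rw [innerRank, ihP, ihR, add_zero]

theorem fullRank_conj {l : List (Query L)} (hl : l ≠ []) (h : ∀ A ∈ l, A.IsLeaf) (ws : List ℕ) :
    fullRank ws (conj l) = blockRank ws l := by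
  rw [fullRank, openLeaves_conj hl h, innerRank_eq_zero (quants_conj h), add_zero]

theorem fullRank_exs_lt {ys ws : List ℕ} {B B' : Query L}
    (h : fullRank (ys.reverse ++ ws) B' < fullRank (ys.reverse ++ ws) B) :
    fullRank ws (exs ys B') < fullRank ws (exs ys B) := by
  induction ys generalizing ws with
  | nil => exact h
  | cons y ys ih =>
    rw [List.reverse_cons, List.append_assoc] at h
    exact add_lt_add_right (ih h) (blockRank ws [])

theorem not_isSide_func_func {n m : ℕ} (f : L.Functions n) (g : L.Functions m)
    (s : Fin n → L.Term ℕ) (t : Fin m → L.Term ℕ) (x : ℕ) :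
    ¬ IsSide (Query.eq (Term.func f s) (Term.func g t)) x := by
  rintro ⟨r, -, h | h⟩ <;> simp at h

theorem not_isSide_of_mem {x : ℕ} {t : L.Term ℕ} (h : x ∈ t.varFinset) (y : ℕ) :
    ¬ IsSide (Query.eq (Term.var x) t) y := by
  rintro ⟨r, hr, e | e⟩
  · obtain ⟨rfl, rfl⟩ : x = y ∧ t = r := by simpa using e
    exact hr h
  · obtain ⟨rfl, rfl⟩ := Query.eq.inj e
    simp only [Term.varFinset, Finset.mem_singleton] at hr h
    exact hr h.symm

/-- Within a block, a subquery is replaced by a smaller one. -/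
structure Simplifies (P P' : Query L) : Prop where
  quants : P'.quants = P.quants
  parallel : P'.parallel = P.parallel
  openWeight : P'.openWeight ≤ P.openWeight
  crossing : P'.crossing ≤ P.crossing
  rank_lt : ∀ ws l r, blockRank ws (l ++ P'.openLeaves ++ r) + innerRank ws P' <
    blockRank ws (l ++ P.openLeaves ++ r) + innerRank ws P

namespace Simplifies

theorem andLeft (R : Query L) {P P' : Query L} (h : Simplifies P P') :
    Simplifies (Query.and P R) (Query.and P' R) := by
  refine ⟨?_, ?_, ?_, ?_, fun ws l r => ?_⟩
  · simp only [Query.quants, h.quants]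
  · simp only [Query.parallel, h.quants, h.parallel]
  · simpa only [openWeight_and] using Nat.add_le_add_right h.openWeight _
  · have := Nat.mul_le_mul_right R.quants h.openWeight
    have := h.crossing
    simp only [Query.crossing, h.quants]
    omega
  · have := add_lt_add_left (h.rank_lt ws l (R.openLeaves ++ r)) (innerRank ws R)
    simpa only [Query.openLeaves, innerRank, List.append_assoc, add_assoc] using this

theorem andRight (R : Query L) {P P' : Query L} (h : Simplifies P P') :
    Simplifies (Query.and R P) (Query.and R P') := by
  refine ⟨?_, ?_, ?_, ?_, fun ws l r => ?_⟩
  · simp only [Query.quants, h.quants]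
  · simp only [Query.parallel, h.quants, h.parallel]
  · simpa only [openWeight_and] using Nat.add_le_add_left h.openWeight _
  · have := Nat.mul_le_mul_right R.quants h.openWeight
    have := h.crossing
    simp only [Query.crossing, h.quants]
    omega
  · have := add_lt_add_right (h.rank_lt ws (l ++ R.openLeaves) r) (innerRank ws R)
    simpa only [Query.openLeaves, innerRank, List.append_assoc, add_left_comm] using this

theorem ex (x : ℕ) {P P' : Query L} (h : Simplifies P P') :
    Simplifies (Query.ex x P) (Query.ex x P') := by
  refine ⟨congrArg (· + 1) h.quants, h.parallel, le_rfl, h.crossing, fun ws l r => ?_⟩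
  simpa only [Query.openLeaves, innerRank, List.append_nil, List.nil_append] using
    add_lt_add_right (h.rank_lt (x :: ws) [] []) _

theorem of_eq {s t : L.Term ℕ} {P : Query L} (he : ∀ x, ¬ IsSide (Query.eq s t) x)
    (hP : P.quants = 0)
    (hv : vars (P.openLeaves : Multiset (Query L)) ⊆ (Query.eq s t).freeVars)
    (hw : P.openWeight < leafWeight (Query.eq s t)) : Simplifies (Query.eq s t) P := by
  have hleaf : IsLeaf (Query.eq s t) := trivial
  refine ⟨hP, parallel_eq_zero hP, (openWeight_of_isLeaf hleaf).symm ▸ hw.le,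
    (crossing_eq_zero hP).le, fun ws l r => ?_⟩
  rw [innerRank_eq_zero hP, innerRank_eq_zero hleaf.quants_eq_zero, add_zero, add_zero,
    hleaf.openLeaves_eq, List.append_assoc l [_]]
  exact blockRank_replace_lt he hv hw ws l r

theorem of_eq_const {s t : L.Term ℕ} {c : Query L} (hc : c = tt ∨ c = ff)
    (he : ∀ x, ¬ IsSide (Query.eq s t) x) : Simplifies (Query.eq s t) c := by
  have := termSize_pos s
  have := termSize_pos t
  refine of_eq he ?_ ?_ ?_ <;> rcases hc with rfl | rfl <;>
    simp [Query.openLeaves, Query.quants, Query.openWeight, weight, leafWeight, vars, freeVars] <;>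
    omega

theorem decompose {n : ℕ} (f : L.Functions n) (s t : Fin n → L.Term ℕ) :
    Simplifies (Query.eq (Term.func f s) (Term.func f t))
      (conj (List.ofFn fun i => Query.eq (s i) (t i))) := by
  have hleaf : ∀ A ∈ List.ofFn fun i => Query.eq (s i) (t i), A.IsLeaf := by
    simp [List.mem_ofFn, IsLeaf]
  have hside := not_isSide_func_func f f s t
  cases n with
  | zero => simpa [conj] using of_eq_const (Or.inl rfl) hside
  | succ n =>
    have hopen := openLeaves_conj (by simp) hleaf
    refine of_eq hside (quants_conj hleaf) ?_ ?_
    · intro v hv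
      rw [hopen, mem_vars] at hv
      obtain ⟨q, hq, hv⟩ := hv
      obtain ⟨i, rfl⟩ := (List.mem_ofFn' _ _).1 (Multiset.mem_coe.1 hq)
      simp only [freeVars, Finset.mem_union, mem_varFinset_func] at hv ⊢
      exact hv.imp (fun h => ⟨i, h⟩) (fun h => ⟨i, h⟩)
    · rw [Query.openWeight, hopen, weight, Multiset.map_coe, Multiset.sum_coe, List.map_ofFn,
        List.sum_ofFn]
      simp only [Function.comp_apply, leafWeight, termSize, Finset.sum_add_distrib,
        ← Finset.mul_sum]
      omega

theorem swap_atom {A : Query L} (hA : A.IsAtom) (s t : L.Term ℕ) :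
    Simplifies (Query.and A (Query.eq s t)) (Query.and (Query.eq s t) A) := by
  have hE : (Query.eq s t).IsEquation := ⟨s, t, rfl⟩
  have hleaf := isLeaf_of_isEquation_or_isAtom (Or.inr hA)
  refine ⟨Nat.add_comm _ _, ?_, ?_, ?_, fun ws l r => ?_⟩
  · simp [Query.parallel, hleaf.quants_eq_zero, add_comm]
  · rw [openWeight_and, openWeight_and, add_comm]
  · simp [Query.crossing, hleaf.quants_eq_zero, Query.quants, add_comm]
  · simpa [Query.openLeaves, hleaf.openLeaves_eq, innerRank,
      innerRank_eq_zero hleaf.quants_eq_zero] using blockRank_swap_lt hA hE ws l r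

theorem not_isSide_tt (x : ℕ) : ¬ IsSide (tt : Query L) x := by
  simp [IsSide]

theorem blockRank_erase_tt_lt (ws : List ℕ) (l r : List (Query L)) :
    blockRank ws (l ++ r) < blockRank ws (l ++ tt :: r) := by
  simpa using blockRank_replace_lt (A := []) not_isSide_tt (by simp [vars])
    (by simp [weight, leafWeight]) ws l r

theorem tt_and (Q : Query L) : Simplifies (Query.and tt Q) Q := by
  refine ⟨by simp [Query.quants], by simp [Query.parallel, Query.quants], ?_, ?_, fun ws l r => ?_⟩
  · rw [openWeight_and]
    exact Nat.le_add_left _ _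
  · simp only [Query.crossing]
    omega
  · simpa [Query.openLeaves, innerRank] using blockRank_erase_tt_lt ws l (Q.openLeaves ++ r)

theorem and_tt (Q : Query L) : Simplifies (Query.and Q tt) Q := by
  refine ⟨rfl, by simp [Query.parallel, Query.quants], ?_, ?_, fun ws l r => ?_⟩
  · rw [openWeight_and]
    exact Nat.le_add_right _ _
  · simp only [Query.crossing]
    omega
  · simpa [Query.openLeaves, innerRank] using blockRank_erase_tt_lt ws (l ++ Q.openLeaves) r

end Simplifies

theorem BlockStep.fullRank_lt {ws : List ℕ} {P P' : Query L} (h : BlockStep ws P P')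
    (rest : List ℕ) : fullRank rest P' < fullRank rest P := by
  obtain ⟨xs, ys, B, B', h⟩ := h
  obtain ⟨l, l', rfl, rfl, hl, hl', hleaf, hleaf', hlt⟩ := h.exists_blockRank_lt
  apply fullRank_exs_lt
  rw [fullRank_conj hl hleaf, fullRank_conj hl' hleaf', List.reverse_append, List.append_assoc]
  exact hlt _

theorem BlockStep.quants_parallel_crossing_eq {ws : List ℕ} {P P' : Query L}
    (h : BlockStep ws P P') :
    P'.quants = P.quants ∧ P'.parallel = P.parallel ∧ P'.crossing = P.crossing := by
  obtain ⟨xs, ys, B, B', h⟩ := h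
  obtain ⟨l, l', rfl, rfl, -, -, hleaf, hleaf', -⟩ := h.exists_blockRank_lt
  have h := quants_conj hleaf
  have h' := quants_conj hleaf'
  simp [quants_exs, parallel_exs, crossing_exs, h, h', parallel_eq_zero, crossing_eq_zero]

theorem BlockStep.simplifies {ws : List ℕ} (hws : ws ≠ []) {P P' : Query L}
    (h : BlockStep ws P P') : Simplifies P P' := by
  obtain ⟨hq, hp, hc⟩ := h.quants_parallel_crossing_eq
  have hlt := h.fullRank_lt
  obtain ⟨B, B', rfl, rfl⟩ : ∃ B B', P = exs ws B ∧ P' = exs ws B' := by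
    obtain ⟨xs, ys, B, B', -⟩ := h
    exact ⟨B, B', rfl, rfl⟩
  obtain ⟨w, ws, rfl⟩ := List.exists_cons_of_ne_nil hws
  exact ⟨hq, hp, le_rfl, hc.le, fun rest l r =>
    add_lt_add_right (lt_of_add_lt_add_left (hlt rest)) _⟩

theorem LocalRule.decreases {P P' : Query L} (h : LocalRule P P') :
    P'.quants < P.quants ∨ Prenexes P P' ∨ Simplifies P P' := by
  cases h with
  | r1 f s t => exact Or.inr (Or.inr (Simplifies.decompose f s t))
  | r2 f g s t _ => exact Or.inr (Or.inr (.of_eq_const (Or.inr rfl) (not_isSide_func_func f g s t)))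
  | r3 x t _ hx => exact Or.inr (Or.inr (.of_eq_const (Or.inr rfl) (not_isSide_of_mem hx)))
  | r4 x => exact Or.inr (Or.inr (.of_eq_const (Or.inl rfl) (not_isSide_of_mem (by simp))))
  | r8 ys zs y Q _ =>
    left
    simp only [quants_exs, List.length_append, List.length_cons]
    omega
  | r9 ys₁ ys₂ zs₁ zs₂ Q₁ Q₂ R₁ R₂ hys hz₁ hz₂ hv₁ hv₂ =>
    have hzs : zs₁ ≠ [] ∨ zs₂ ≠ [] := by
      simpa only [ne_eq, ← List.length_eq_zero_iff, hz₁, hz₂] using hys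
    exact Or.inr (Or.inl ((Prenexes.exs hzs R₁ R₂).of_shape_eq
      (shape_and hv₁.shape_eq hv₂.shape_eq)))
  | r10 A s t hA => exact Or.inr (Or.inr (Simplifies.swap_atom hA s t))
  | r11_left => exact Or.inr (Or.inr (Simplifies.tt_and _))
  | r11_right => exact Or.inr (Or.inr (Simplifies.and_tt _))

theorem Everywhere.decreases {r : Query L → Query L → Prop}
    (hr : ∀ P P', r P P' → P'.quants < P.quants ∨ Prenexes P P' ∨ Simplifies P P')
    {Q Q' : Query L} (h : Everywhere r Q Q') :
    Q'.quants < Q.quants ∨ Prenexes Q Q' ∨ Simplifies Q Q' := by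
  induction h with
  | here h => exact hr _ _ h
  | andLeft R _ ih =>
    exact ih.imp (fun h => Nat.add_lt_add_right h _) (Or.imp (.andLeft R) (.andLeft R))
  | andRight R _ ih =>
    exact ih.imp (fun h => Nat.add_lt_add_left h _) (Or.imp (.andRight R) (.andRight R))
  | ex x _ ih => exact ih.imp Nat.succ_lt_succ (Or.imp (.ex x) (.ex x))

theorem rank_lt_of_decreases {Q Q' : Query L}
    (h : Q'.quants < Q.quants ∨ Prenexes Q Q' ∨ Simplifies Q Q') : rank Q' < rank Q := by
  simp only [rank, Prod.Lex.toLex_lt_toLex]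
  rcases h with h | h | h
  · exact Or.inl h
  · exact Or.inr ⟨h.quants, h.parallel.imp_right (And.imp_right Or.inl)⟩
  · refine Or.inr ⟨h.quants, Or.inr ⟨h.parallel, h.crossing.lt_or_eq.imp_right fun hc => ⟨hc, ?_⟩⟩⟩
    simpa only [fullRank, List.nil_append, List.append_nil] using h.rank_lt [] [] []

theorem Elementary.rank_lt {Q Q' : Query L} (h : Elementary Q Q') : Q' = ff ∨ rank Q' < rank Q := by
  cases h with
  | anywhere h => exact Or.inr (rank_lt_of_decreases (h.decreases fun _ _ => LocalRule.decreases))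
  | wholeBlock ws h =>
    obtain ⟨hq, hp, hc⟩ := h.quants_parallel_crossing_eq
    right
    simpa only [rank, hq, hp, hc, Prod.Lex.toLex_lt_toLex, lt_irrefl, true_and, false_or] using
      h.fullRank_lt []
  | innerBlock h =>
    exact Or.inr (rank_lt_of_decreases (h.decreases fun _ _ ⟨_, hws, h⟩ =>
      Or.inr (Or.inr (h.simplifies hws))))
  | r12 h => exact Or.inl rfl

theorem AssocEq.rank_eq {P P' : Query L} (h : AssocEq P P') : rank P' = rank P := by
  have hF := h.congr (F := fun Q => (Q.quants, Q.parallel, Q.openLeaves, Q.crossing,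
    fun ws => innerRank ws Q)) ?_ ?_ ?_
  · simp only [Prod.mk.injEq, funext_iff] at hF
    simp only [rank, fullRank, hF]
  · intro P Q R
    simp only [quants, parallel, openLeaves, crossing, innerRank, openWeight_and, Prod.mk.injEq,
      List.append_assoc, add_assoc, true_and, and_true]
    constructor <;> ring
  · intro P P' R R' hP hR
    simp only [Prod.mk.injEq, funext_iff] at hP hR
    simp [quants, parallel, openLeaves, crossing, innerRank, openWeight, hP, hR]
  · intro x P P' h
    simp only [Prod.mk.injEq, funext_iff] at h
    simp [quants, parallel, openLeaves, crossing, innerRank, h]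

theorem Step.rank_lt {Q Q' : Query L} (h : Step Q Q') : Q' = ff ∨ rank Q' < rank Q := by
  obtain ⟨-, P, P', hP, h, hP'⟩ := h
  rw [← eq_iff_of_assocEq (Or.inr rfl) hP', hP'.rank_eq, ← hP.rank_eq]
  exact h.rank_lt

theorem wellFounded_step : WellFounded fun Q' Q : Query L => Step Q Q' := by
  have hacc : Acc (fun Q' Q : Query L => Step Q Q') ff := ⟨_, fun _ h => absurd rfl h.1⟩
  refine ⟨fun Q => ?_⟩
  induction Q using (InvImage.wf (rank (L := L)) wellFounded_lt).induction with
  | _ Q ih =>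
    refine ⟨Q, fun Q' h => ?_⟩
    rcases h.rank_lt with rfl | h
    · exact hacc
    · exact ih Q' h

theorem exists_output (Q : Query L) : ∃ Q', Output Q Q' := by
  induction Q using (wellFounded_step (L := L)).induction with
  | _ Q ih =>
    by_cases h : ∃ R, Step Q R
    · obtain ⟨R, hR⟩ := h
      obtain ⟨Q', hQ', h⟩ := ih R hR
      exact ⟨Q', hQ'.head hR, h⟩
    · exact ⟨Q, Relation.ReflTransGen.refl, Or.inr h⟩

/-! ### Terminal queries -/

namespace AssocEq

theorem refl (P : Query L) : AssocEq P P := Relation.EqvGen.refl P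

theorem symm {P Q : Query L} (h : AssocEq P Q) : AssocEq Q P := Relation.EqvGen.symm _ _ h

theorem trans {P Q R : Query L} (h : AssocEq P Q) (h' : AssocEq Q R) : AssocEq P R :=
  Relation.EqvGen.trans _ _ _ h h'

theorem assoc (P Q R : Query L) :
    AssocEq (Query.and (Query.and P Q) R) (Query.and P (Query.and Q R)) :=
  Relation.EqvGen.rel _ _ (Everywhere.here (AssocRule.assoc P Q R))

theorem map {f : Query L → Query L}
    (hf : ∀ P Q, Everywhere AssocRule P Q → Everywhere AssocRule (f P) (f Q))
    {P Q : Query L} (h : AssocEq P Q) : AssocEq (f P) (f Q) := by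
  induction h with
  | rel _ _ h => exact Relation.EqvGen.rel _ _ (hf _ _ h)
  | refl => exact refl _
  | symm _ _ _ ih => exact ih.symm
  | trans _ _ _ _ _ ih ih' => exact ih.trans ih'

theorem and {P P' R R' : Query L} (h : AssocEq P P') (h' : AssocEq R R') :
    AssocEq (Query.and P R) (Query.and P' R') :=
  (h.map fun _ _ => Everywhere.andLeft R).trans (h'.map fun _ _ => Everywhere.andRight P')

theorem exs (ys : List ℕ) {P P' : Query L} (h : AssocEq P P') :
    AssocEq (Query.exs ys P) (Query.exs ys P') := by
  induction ys with
  | nil => exact h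
  | cons y ys ih => exact ih.map fun _ _ => Everywhere.ex y

theorem conj_append {l l' : List (Query L)} (h : l ≠ []) (h' : l' ≠ []) :
    AssocEq (Query.and (conj l) (conj l')) (conj (l ++ l')) := by
  induction l with
  | nil => exact absurd rfl h
  | cons A l ih =>
    cases l with
    | nil =>
      rw [List.singleton_append, conj_cons h']
      exact refl _
    | cons B l =>
      have hl : B :: l ≠ [] := List.cons_ne_nil _ _
      rw [List.cons_append, conj_cons hl, conj_cons (List.append_ne_nil_of_left_ne_nil hl l')]
      exact (assoc _ _ _).trans ((refl A).and (ih hl))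

theorem conj_append_and (l₁ : List (Query L)) (A B : Query L) (l₂ : List (Query L)) :
    AssocEq (conj (l₁ ++ A :: B :: l₂)) (conj (l₁ ++ Query.and A B :: l₂)) := by
  induction l₁ with
  | nil =>
    cases l₂ with
    | nil => exact refl _
    | cons C l₂ => exact (assoc A B _).symm
  | cons C l₁ ih =>
    rw [List.cons_append, List.cons_append, conj_cons (by simp), conj_cons (by simp)]
    exact (refl C).and ih

end AssocEq

namespace Everywhere

variable {r : Query L → Query L → Prop}

theorem exs (ys : List ℕ) {P P' : Query L} (h : Everywhere r P P') :
    Everywhere r (Query.exs ys P) (Query.exs ys P') := by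
  induction ys with
  | nil => exact h
  | cons y ys ih => exact ih.ex y

theorem conj {A A' : Query L} (h : r A A') (l₁ l₂ : List (Query L)) :
    Everywhere r (Query.conj (l₁ ++ A :: l₂)) (Query.conj (l₁ ++ A' :: l₂)) := by
  induction l₁ with
  | nil =>
    cases l₂ with
    | nil => exact here h
    | cons B l₂ => exact (here h).andLeft _
  | cons B l₁ ih =>
    rw [List.cons_append, List.cons_append, conj_cons (by simp), conj_cons (by simp)]
    exact ih.andRight B

end Everywhere

namespace Query

theorem hasFF_exs {ys : List ℕ} {Q : Query L} (h : Q.HasFF) : (exs ys Q).HasFF := by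
  induction ys with
  | nil => exact h
  | cons _ _ ih => exact ih

theorem hasFF_conj {l : List (Query L)} (h : ff ∈ l) : (conj l).HasFF := by
  induction l with
  | nil => simp at h
  | cons A l ih =>
    cases l with
    | nil => exact List.mem_singleton.1 h ▸ trivial
    | cons B l =>
      rcases List.mem_cons.1 h with rfl | h
      · exact Or.inl trivial
      · exact Or.inr (ih h)

theorem isLeaf_of_mem_openLeaves {Q A : Query L} (h : A ∈ Q.openLeaves) : A.IsLeaf := by
  induction Q with
  | and P R ihP ihR => exact (List.mem_append.1 h).elim ihP ihR
  | ex x P => simp [openLeaves] at h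
  | _ => exact List.mem_singleton.1 h ▸ trivial

theorem openLeaves_ne_nil {Q : Query L} (h : Q.quants = 0) : Q.openLeaves ≠ [] := by
  induction h using quants_eq_zero_induction with
  | leaf A hA => simp [hA.openLeaves_eq]
  | and P R _ _ ihP _ => exact List.append_ne_nil_of_left_ne_nil ihP _

theorem assocEq_conj_openLeaves {Q : Query L} (h : Q.quants = 0) :
    AssocEq Q (conj Q.openLeaves) := by
  induction h using quants_eq_zero_induction with
  | leaf A hA =>
    rw [hA.openLeaves_eq]
    exact AssocEq.refl A
  | and P R hP hR ihP ihR =>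
    exact (ihP.and ihR).trans
      (AssocEq.conj_append (openLeaves_ne_nil hP) (openLeaves_ne_nil hR))

theorem finite_setOf_not_substitutible_var (x : ℕ) (Q : Query L) :
    {z | ¬ Q.Substitutible x (Term.var z)}.Finite := by
  induction Q with
  | and P R ihP ihR =>
    exact (ihP.union ihR).subset fun z hz => not_and_or.1 hz
  | ex y P ih =>
    refine (ih.insert y).subset fun z hz => or_iff_not_imp_left.2 fun hzy hP => hz (Or.inr ⟨?_, hP⟩)
    rw [mem_varFinset_var]
    exact Ne.symm hzy
  | _ => simp [Substitutible]

end Query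

theorem exists_variant_ex (x : ℕ) (P : Query L) (S : Finset ℕ) :
    ∃ z P', z ∉ S ∧ Variant (Query.ex x P) (Query.ex z P') := by
  obtain ⟨z, hz⟩ := ((finite_setOf_not_substitutible_var x P).union
    (P.freeVars ∪ S).finite_toSet).exists_notMem
  simp only [Finset.coe_union, Set.mem_union, Set.mem_ofPred_eq, SetLike.mem_coe, not_or,
    not_not] at hz
  exact ⟨z, _, hz.2.2, Relation.ReflTransGen.single
    (Everywhere.here (RenameRule.rename x z P hz.2.1 hz.1))⟩

theorem exists_localRule_ex_and (x : ℕ) (P R : Query L) :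
    ∃ X, LocalRule (Query.and (Query.ex x P) R) X := by
  obtain ⟨z, P', hz, h⟩ := exists_variant_ex x P R.freeVars
  exact ⟨_, LocalRule.r9 [x] [] [z] [] P R P' R (by simp) rfl rfl h Relation.ReflTransGen.refl
    (by simp) (by simpa using hz)⟩

theorem exists_localRule_and_ex (x : ℕ) (P R : Query L) :
    ∃ X, LocalRule (Query.and R (Query.ex x P)) X := by
  obtain ⟨z, P', hz, h⟩ := exists_variant_ex x P R.freeVars
  exact ⟨_, LocalRule.r9 [] [x] [] [z] R P R P' (by simp) rfl rfl Relation.ReflTransGen.refl h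
    (by simpa using hz) (by simp)⟩

theorem exists_localRule_or_prenex (Q : Query L) : (∃ X, Everywhere LocalRule Q X) ∨
    ∃ ws B, B.quants = 0 ∧ Q = exs ws B := by
  induction Q with
  | and P R ihP ihR =>
    rcases ihP with ⟨X, h⟩ | ⟨ws, B, hB, rfl⟩
    · exact Or.inl ⟨_, h.andLeft R⟩
    rcases ihR with ⟨X, h⟩ | ⟨ws', B', hB', rfl⟩
    · exact Or.inl ⟨_, h.andRight _⟩
    rcases ws with _ | ⟨x, ws⟩
    · rcases ws' with _ | ⟨x, ws'⟩
      · exact Or.inr ⟨[], Query.and B B', by simp [quants, hB, hB'], rfl⟩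
      · exact Or.inl ((exists_localRule_and_ex x (exs ws' B') B).imp fun _ => Everywhere.here)
    · exact Or.inl ((exists_localRule_ex_and x (exs ws B) (exs ws' B')).imp
        fun _ => Everywhere.here)
  | ex x P ih =>
    rcases ih with ⟨X, h⟩ | ⟨ws, B, hB, rfl⟩
    · exact Or.inl ⟨_, h.ex x⟩
    · exact Or.inr ⟨x :: ws, B, hB, rfl⟩
  | _ => exact Or.inr ⟨[], _, rfl, rfl⟩

theorem exists_eqs_append_atoms {l : List (Query L)}
    (hchain : l.IsChain fun A B => A.IsAtom → ¬ B.IsEquation)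
    (hl : ∀ A ∈ l, (∃ x t, A = eq (Term.var x) t) ∨ A.IsAtom) :
    ∃ (eqs : List (ℕ × L.Term ℕ)) (atoms : List (Query L)),
      l = eqs.map (fun e => eq (Term.var e.1) e.2) ++ atoms ∧ ∀ A ∈ atoms, A.IsAtom := by
  induction l with
  | nil => exact ⟨[], [], rfl, by simp⟩
  | cons A l ih =>
    obtain ⟨hA, hl⟩ := List.forall_mem_cons.1 hl
    obtain ⟨eqs, atoms, rfl, hatoms⟩ := ih hchain.tail hl
    rcases hA with ⟨x, t, rfl⟩ | hA
    · exact ⟨(x, t) :: eqs, atoms, rfl, hatoms⟩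
    · cases eqs with
      | nil => exact ⟨[], A :: atoms, rfl, List.forall_mem_cons.2 ⟨hA, hatoms⟩⟩
      | cons e eqs => exact absurd ⟨_, _, rfl⟩ (hchain.rel hA)

/-- A query on which the algorithm stops without having returned `ff`. -/
def Terminal (Q : Query L) : Prop := Q ≠ ff ∧ ¬ ∃ R, Step Q R

theorem forall_mem_append_of_append_cons {α : Type*} {p : α → Prop} {l₁ l₂ : List α} {a : α}
    (h : ∀ b ∈ l₁ ++ a :: l₂, p b) : ∀ b ∈ l₁ ++ l₂, p b := fun b hb =>
  h b (((List.sublist_cons_self a l₂).append_left l₁).subset hb)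

theorem pairwise_of_forall_append {α : Type*} {R : α → α → Prop} {l : List α}
    (h : ∀ l₁ a l₂, l = l₁ ++ a :: l₂ → ∀ b ∈ l₂, R a b) : l.Pairwise R := by
  induction l with
  | nil => exact List.Pairwise.nil
  | cons a l ih =>
    refine List.Pairwise.cons (h [] a l rfl) (ih fun l₁ b l₂ hl => h (a :: l₁) b l₂ ?_)
    rw [hl, List.cons_append]

namespace Terminal

variable {Q A B X : Query L} {ws ws₁ ws₂ : List ℕ} {l l₁ l₂ : List (Query L)} {x y z : ℕ}
  {s s' t : L.Term ℕ}

theorem of_assocEq {P : Query L} (h : Terminal Q) (hQ : AssocEq Q P) : Terminal P :=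
  ⟨fun hP => h.1 ((eq_iff_of_assocEq (Or.inr rfl) hQ).2 hP),
    fun ⟨R, _, P₁, P₂, h₁, h₂, h₃⟩ => h.2 ⟨R, h.1, P₁, P₂, hQ.trans h₁, h₂, h₃⟩⟩

theorem not_elementary (h : Terminal Q) : ¬ Elementary Q X := fun hX =>
  h.2 ⟨X, h.1, Q, X, AssocEq.refl Q, hX, AssocEq.refl X⟩

theorem not_localRule (h : Terminal (exs ws (conj (l₁ ++ A :: l₂)))) : ¬ LocalRule A X := fun hX =>
  h.not_elementary (Elementary.anywhere ((Everywhere.conj hX l₁ l₂).exs ws))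

theorem not_localRule_and (h : Terminal (exs ws (conj (l₁ ++ A :: B :: l₂)))) :
    ¬ LocalRule (Query.and A B) X :=
  (h.of_assocEq ((AssocEq.conj_append_and l₁ A B l₂).exs ws)).not_localRule

theorem not_blockRule (h : Terminal (exs ws Q)) : ¬ BlockRule ws Q X := fun hX =>
  h.not_elementary (Elementary.wholeBlock ws (BlockStep.intro [] ws Q X hX))

theorem mem_freeVars_exs (h : Terminal (exs (ws₁ ++ y :: ws₂) Q)) : y ∈ (exs ws₂ Q).freeVars :=
  by_contra fun hy => h.not_elementary
    (Elementary.anywhere (Everywhere.here (LocalRule.r8 ws₁ ws₂ y Q hy)))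

theorem mem_freeVars (h : Terminal (exs ws Q)) (hz : z ∈ ws) : z ∈ Q.freeVars := by
  obtain ⟨ws₁, ws₂, rfl⟩ := List.append_of_mem hz
  exact (Query.mem_freeVars_exs.1 h.mem_freeVars_exs).1

theorem nodup (h : Terminal (exs ws Q)) : ws.Nodup :=
  pairwise_of_forall_append fun ws₁ y ws₂ hws y' hy' hyy' => by
    subst hws hyy'
    exact (Query.mem_freeVars_exs.1 h.mem_freeVars_exs).2 hy'

theorem exists_assocEq_exs_conj (h : Terminal Q) :
    ∃ ws l, (∀ A ∈ l, A.IsLeaf) ∧ AssocEq Q (exs ws (conj l)) := by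
  rcases exists_localRule_or_prenex Q with ⟨X, hX⟩ | ⟨ws, B, hB, rfl⟩
  · exact absurd (Elementary.anywhere hX) h.not_elementary
  · exact ⟨ws, B.openLeaves, fun A => isLeaf_of_mem_openLeaves,
      (assocEq_conj_openLeaves hB).exs ws⟩

theorem tt_notMem (h : Terminal (exs ws (conj l))) (hl : l ≠ [tt]) : tt ∉ l := by
  intro htt
  obtain ⟨l₁, l₂, rfl⟩ := List.append_of_mem htt
  rcases l₂ with _ | ⟨B, l₂⟩
  · rcases List.eq_nil_or_concat' l₁ with rfl | ⟨l₁, A, rfl⟩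
    · exact hl rfl
    · rw [List.append_assoc] at h
      exact h.not_localRule_and (LocalRule.r11_right A)
  · exact h.not_localRule_and (LocalRule.r11_left B)

theorem ff_notMem (h : Terminal (exs ws (conj l))) : ff ∉ l := fun hff =>
  h.not_elementary (Elementary.r12 _ (hasFF_exs (hasFF_conj hff)))

theorem isEquation_or_isAtom (h : Terminal (exs ws (conj l))) (hl : l ≠ [tt])
    (hleaf : ∀ A ∈ l, A.IsLeaf) : ∀ A ∈ l, A.IsEquation ∨ A.IsAtom := by
  intro A hA
  cases A with
  | tt => exact absurd hA (h.tt_notMem hl)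
  | ff => exact absurd hA h.ff_notMem
  | eq s t => exact Or.inl ⟨s, t, rfl⟩
  | atom p ts => exact Or.inr ⟨_, p, ts, rfl⟩
  | and P R => exact (hleaf _ hA).elim
  | ex x P => exact (hleaf _ hA).elim

theorem isChain (h : Terminal (exs ws (conj l))) :
    l.IsChain fun A B => A.IsAtom → ¬ B.IsEquation := by
  rw [List.isChain_iff_forall_rel_of_append_cons_cons]
  rintro A B l₁ l₂ rfl hA ⟨s, t, rfl⟩
  exact h.not_localRule_and (LocalRule.r10 A s t hA)

theorem exists_left_eq_var (h : Terminal (exs ws (conj l)))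
    (hl : ∀ A ∈ l, A.IsEquation ∨ A.IsAtom) (he : eq s t ∈ l) : ∃ x, s = Term.var x := by
  obtain ⟨l₁, l₂, rfl⟩ := List.append_of_mem he
  cases s with
  | var x => exact ⟨x, rfl⟩
  | @func n f ss =>
    exfalso
    cases t with
    | var x =>
      exact h.not_blockRule (BlockRule.r7 ws l₁ l₂ x _ (forall_mem_append_of_append_cons hl)
        (Or.inl fun z => by simp))
    | @func m g ts =>
      by_cases hfg : (⟨n, f⟩ : Σ k, L.Functions k) = ⟨m, g⟩
      · cases hfg
        exact h.not_localRule (LocalRule.r1 f ss ts)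
      · exact h.not_localRule (LocalRule.r2 f g ss ts hfg)

theorem notMem_varFinset_right (h : Terminal (exs ws (conj l))) (he : eq (Term.var x) t ∈ l) :
    x ∉ t.varFinset := by
  obtain ⟨l₁, l₂, rfl⟩ := List.append_of_mem he
  intro hx
  by_cases ht : t = Term.var x
  · subst ht
    exact h.not_localRule (LocalRule.r4 x)
  · exact h.not_localRule (LocalRule.r3 x t ht hx)

theorem left_notMem (h : Terminal (exs ws (conj l))) (hl : ∀ A ∈ l, A.IsEquation ∨ A.IsAtom)
    (he : eq (Term.var x) t ∈ l) : x ∉ ws := by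
  have hxt := h.notMem_varFinset_right he
  obtain ⟨l₁, l₂, rfl⟩ := List.append_of_mem he
  exact fun hx => h.not_blockRule
    (BlockRule.r6 ws l₁ l₂ x t (forall_mem_append_of_append_cons hl) hxt hx)

theorem left_notMem_freeVars (h : Terminal (exs ws (conj (l₁ ++ eq (Term.var x) t :: l₂))))
    (hl : ∀ A ∈ l₁ ++ eq (Term.var x) t :: l₂, A.IsEquation ∨ A.IsAtom) :
    ∀ A ∈ l₁ ++ l₂, x ∉ A.freeVars := by
  have he : eq (Term.var x) t ∈ l₁ ++ eq (Term.var x) t :: l₂ := by simp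
  exact fun A hA hx => h.not_blockRule (BlockRule.r5 ws l₁ l₂ x t
    (forall_mem_append_of_append_cons hl) (h.notMem_varFinset_right he) (h.left_notMem hl he)
    ⟨A, hA, hx⟩)

theorem right_ne_var (h : Terminal (exs ws (conj l))) (hl : ∀ A ∈ l, A.IsEquation ∨ A.IsAtom)
    (he : eq (Term.var x) t ∈ l) (hz : z ∈ ws) : t ≠ Term.var z := by
  have hx := h.left_notMem hl he
  rintro rfl
  obtain ⟨l₁, l₂, rfl⟩ := List.append_of_mem he
  exact h.not_blockRule (BlockRule.r7 ws l₁ l₂ z _ (forall_mem_append_of_append_cons hl)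
    (Or.inr ⟨x, rfl, fun hxz => hx (hxz ▸ hz), hx, hz⟩))

theorem left_notMem_right (h : Terminal (exs ws (conj l)))
    (hl : ∀ A ∈ l, A.IsEquation ∨ A.IsAtom) (he : eq (Term.var x) t ∈ l)
    (he' : eq s s' ∈ l) : x ∉ s'.varFinset := by
  by_cases hee' : eq s s' = eq (Term.var x) t
  · cases hee'
    exact h.notMem_varFinset_right he
  · obtain ⟨l₁, l₂, rfl⟩ := List.append_of_mem he
    have hmem : eq s s' ∈ l₁ ++ l₂ := by simpa [hee'] using he'
    have hx := h.left_notMem_freeVars hl _ hmem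
    exact fun hxs => hx (Finset.mem_union_right _ hxs)

theorem pairwise_left_notMem_freeVars (h : Terminal (exs ws (conj l)))
    (hl : ∀ A ∈ l, A.IsEquation ∨ A.IsAtom) :
    l.Pairwise fun A B => ∀ x t, A = eq (Term.var x) t → x ∉ B.freeVars := by
  refine pairwise_of_forall_append fun l₁ A l₂ hsplit B hB x t hA => ?_
  subst hsplit hA
  exact h.left_notMem_freeVars hl B (List.mem_append_right _ hB)

theorem inSolvedForm (h : Terminal Q) : InSolvedForm Q := by
  obtain ⟨ws, l, hleaf, hQ⟩ := h.exists_assocEq_exs_conj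
  replace h := h.of_assocEq hQ
  by_cases htt : l = [tt]
  · subst htt
    cases ws with
    | nil => exact Or.inl ((eq_iff_of_assocEq (Or.inl rfl) hQ).2 rfl)
    | cons y ys => exact absurd (h.mem_freeVars (List.mem_cons_self ..)) (Finset.notMem_empty y)
  have hl := h.isEquation_or_isAtom htt hleaf
  have hvar : ∀ A ∈ l, (∃ x t, A = eq (Term.var x) t) ∨ A.IsAtom := fun A hA =>
    (hl A hA).imp_left <| by
      rintro ⟨s, t, rfl⟩
      obtain ⟨x, rfl⟩ := h.exists_left_eq_var hl hA
      exact ⟨x, t, rfl⟩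
  obtain ⟨eqs, atoms, rfl, hatoms⟩ := exists_eqs_append_atoms h.isChain hvar
  have hmem : ∀ e ∈ eqs, eq (Term.var e.1) e.2 ∈
      eqs.map (fun e => eq (Term.var e.1) e.2) ++ atoms := fun e he =>
    List.mem_append_left _ (List.mem_map_of_mem he)
  obtain ⟨heqs, -, heqs_atoms⟩ := List.pairwise_append.1 (h.pairwise_left_notMem_freeVars hl)
  refine Or.inr (Or.inr ⟨ws, eqs, atoms, _, rfl, hQ, hatoms, ?_, ?_, fun z => h.mem_freeVars,
    fun z hz e he => h.right_ne_var hl (hmem e he) hz⟩)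
  · refine List.nodup_append.2 ⟨?_, h.nodup, ?_⟩
    · rw [List.pairwise_map] at heqs
      refine List.pairwise_map.2 (heqs.imp fun hee' hx => ?_)
      exact hee' _ _ rfl (by simp [freeVars, hx])
    · rintro x hx _ hz rfl
      obtain ⟨e, he, rfl⟩ := List.mem_map.1 hx
      exact h.left_notMem hl (hmem e he) hz
  · intro x hx
    obtain ⟨e, he, rfl⟩ := List.mem_map.1 hx
    exact ⟨fun e' he' => h.left_notMem_right hl (hmem e he) (hmem e' he'),
      fun A hA => heqs_atoms _ (List.mem_map_of_mem he) A hA _ _ rfl⟩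

end Terminal

end ConjQuery

theorem mainTheorem1 (L : FirstOrder.Language.{u, v}) (Q : ConjQuery.Query L) :
    (¬ ∃ run : ℕ → ConjQuery.Query L,
        run 0 = Q ∧ ∀ n, ConjQuery.Step (run n) (run (n + 1))) ∧
    (∃ Q', ConjQuery.Output Q Q') ∧
    (∀ Q', ConjQuery.Output Q Q' →
      ConjQuery.InSolvedForm Q' ∧
      (Q' ≠ ConjQuery.Query.ff ∨ Q.card = 0 → ConjQuery.Equivalent.{u, v, w} Q Q') ∧
      (Q' = ConjQuery.Query.ff → ConjQuery.Unsolvable.{u, v, w} Q) ∧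
      ConjQuery.FEAEquivalent.{u, v, w} Q Q') := by
  refine ⟨fun ⟨run, _, hrun⟩ => ?_, ConjQuery.exists_output Q, fun Q' ⟨hreach, hterm⟩ => ⟨?_, ?_⟩⟩
  · exact (wellFounded_iff_isEmpty_descending_chain.1 ConjQuery.wellFounded_step).false ⟨run, hrun⟩
  · by_cases hff : Q' = ConjQuery.Query.ff
    · exact Or.inr (Or.inl hff)
    · exact ConjQuery.Terminal.inSolvedForm ⟨hff, hterm.resolve_left hff⟩
  rcases ConjQuery.equivalent_or_unsolvable_of_reachable hreach with hequiv | ⟨rfl, hunsol⟩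
  · refine ⟨fun _ => hequiv, ?_, hequiv.feaEquivalent⟩
    rintro rfl
    exact hequiv.unsolvable (ConjQuery.unsolvable_of_hasFF trivial)
  · exact ⟨fun h => hunsol.equivalent_ff (h.resolve_left fun hne => hne rfl), fun _ => hunsol,
      hunsol.feaEquivalent_ff⟩
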